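/- **Setting.** One item is sold to $n\ge 2$ bidders whose non-negative values are drawn from a product distribution $\mathbf D=D_1\times\dots\times D_n$. A mechanism consists of an allocation rule $\mathbf x$ ($x_i\ge 0$, $\sum_i x_i\le 1$) and a payment rule. It is Bayesian incentive compatible (BIC) for $\mathbf D$ if for each bidder and each value $v_i \ge 0$, bidding truthfully maximizes the interim expected utility and makes it non-negative. Let $\mathrm{Rev}(M,\mathbf D)$ be the expected sum of payments under truthful bidding, and let $\mathrm{Opt}(\mathbf D)$ be the supremum of $\mathrm{Rev}(M,\mathbf D)$ over all mechanisms $M$ that are BIC for $\mathbf D$. Value distributions are mixtures of a discrete distribution and a distribution with a density (no singular continuous part). The virtual value is $\phi(v)=v-\frac{\Pr[V>v]}{f(v)}$ where $D$ has density $f$ and no atom at $v$, and $\phi(v)=v-(v^+-v)\frac{\Pr[V>v]}{\Pr[V=v]}$ at an atom $v$, where $v^+$ is the infimum of the part of the support above $v$ (so $\phi(v)=v$ if $\Pr[V>v]=0$). $D$ is regular if $\phi$ is non-decreasing on the values of $D$ and, throughout the range of values, the density is positive except on gaps between an atom and the next value. Pointwise conditions on $\phi$, $f$ and density ratios are understood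 up to null sets of the respective distribution (Lebesgue-null sets for positivity of the density). Let $D_{\mathrm{SKL}}(P,Q)=D_{\mathrm{KL}}(P\|Q)+D_{\mathrm{KL}}(Q\|P)\in[0,\infty]$. **Conditions.** Let $v_0,v_2\in(0,\infty)$, $v_1\in(0,+\infty]$, $0<p\le\frac1n$ and $\Delta>0$, and let $D^b,D^h,D^\ell$ be value distributions such that, with $\phi^h,\phi^\ell$ the virtual values of $D^h,D^\ell$: a) $D^b$ is a point mass at $v_0$; b) $\Pr[v\ge v_2]\le\frac1n$ for both $D^h$ and $D^\ell$; c) $\Pr[v_1>v\ge v_2]\ge p$ for both $D^h$ and $D^\ell$; d) $\phi^\ell(v)+\Delta\le v_0\le\phi^h(v)-\Delta$ for $v_1>v\ge v_2$; e) $\phi^h(v),\phi^\ell(v)\le v_0$ for $v<v_2$; f) on $[v_2,v_1)$, $D^\ell$ is absolutely continuous with respect to $D^h$ and $\frac1{\sqrt2}\le\frac{dD^\ell}{dD^h}(v)\le\sqrt2$; g) $D^h$ is regular; h) either $v_1=+\infty$, or $v_1$ is an atom of both $D^h$ and $D^\ell$ and an upper bound of the values of both. Let $\mathcal H$ be the set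 of product distributions $\mathbf D$ with $D_1=D^b$ and $D_i\in\{D^h,D^\ell\}$ for $2\le i\le n$. **Lemma.** There are universal constants $c_1,c_2>0$ such that the following holds for all $n\ge2$ and all $D^b,D^h,D^\ell,v_0,v_1,v_2,p,\Delta$ as above. If a (possibly randomized) algorithm takes $m$ i.i.d. samples from $\mathbf D$ and, for every $\mathbf D\in\mathcal H$, returns with probability at least $0.99$ a mechanism that is BIC for $\mathbf D$ and has expected revenue at least $\mathrm{Opt}(\mathbf D)-c_1\,n\,p\,\Delta$, then $$m\ \ge\ \frac{c_2}{D_{\mathrm{SKL}}(D^h,D^\ell)}.$$ -/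

import Mathlib

open MeasureTheory Set

noncomputable section

/-! ### Value distributions, virtual values, regularity -/

/-- A distribution of non-negative values that is a mixture of a discrete part and a part with a
density. These are the distributions for which virtual values are defined. -/
structure IsValueDistribution (D : Measure ℝ) : Prop where
  prob : IsProbabilityMeasure D
  nonneg : D (Iio 0) = 0
  mixture : ∃ S : Set ℝ, S.Countable ∧ D.restrict Sᶜ ≪ volume

/-- The next value above `v`: the infimum of the part of the support strictly above `v`.
(Only used multiplied by `Pr[V > v]`, hence irrelevant when there is no value above `v`.) -/
def nextValue (D : Measure ℝ) (v : ℝ) : ℝ :=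
  sInf {w : ℝ | v < w ∧ 0 < D (Ioc v w)}

/-- The virtual value `φ(v) = v - (1 - F(v)) / f(v)`. Where `D` has no atom, `f` is the density.
At an atom, `f(v)` is the probability mass and the quotient is multiplied by the distance to the
next value (which is `1` for consecutive integers); equivalently, `φ(v)` is the slope of the
revenue curve over the quantile interval of the atom. -/
def virtualValue (D : Measure ℝ) (v : ℝ) : ℝ :=
  open Classical in
  if D {v} ≠ 0 then
    v - (nextValue D v - v) * (D.real (Ioi v) / D.real {v})
  else
    v - D.real (Ioi v) / (D.rnDeriv volume v).toReal

/-- Regularity: the virtual value is non-decreasing on the values of `D` (up to a null set), and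
the density is positive throughout the range of values, except on the gaps between an atom and the
next value (these gaps are taken into account by the virtual value of the atom). -/
structure IsRegularDistribution (D : Measure ℝ) : Prop where
  monotone : ∃ S : Set ℝ, D Sᶜ = 0 ∧ MonotoneOn (virtualValue D) S
  positive_density : ∀ᵐ t : ℝ, 0 < D (Iio t) → 0 < D (Ioi t) →
    D.rnDeriv volume t ≠ 0 ∨ ∃ a < t, 0 < D {a} ∧ D (Ioc a t) = 0

/-! ### Mechanisms -/

/-- A direct revelation mechanism for one item and `n` bidders: given the bids, `alloc b i` is the
probability that bidder `i` gets the item, and `pay b i` her expected payment. -/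
structure Mechanism (n : ℕ) where
  alloc : (Fin n → ℝ) → Fin n → ℝ
  pay : (Fin n → ℝ) → Fin n → ℝ
  measurable_alloc : ∀ i, Measurable fun b => alloc b i
  measurable_pay : ∀ i, Measurable fun b => pay b i
  alloc_nonneg : ∀ b, (∀ j, 0 ≤ b j) → ∀ i, 0 ≤ alloc b i
  alloc_sum_le_one : ∀ b, (∀ j, 0 ≤ b j) → ∑ i, alloc b i ≤ 1

/-- The expected utility of bidder `i` with value `v` and bid `b`, when the others bid truthfully
and their values are drawn from the product distribution `D`. (The `i`-th coordinate of the random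
value profile is overwritten by the bid `b`.) -/
def interimUtility {n : ℕ} (M : Mechanism n) (D : Fin n → Measure ℝ) (i : Fin n) (v b : ℝ) : ℝ :=
  ∫ w, (v * M.alloc (Function.update w i b) i - M.pay (Function.update w i b) i) ∂(Measure.pi D)

/-- Bayesian incentive compatibility (with interim individual rationality) with respect to `D`.
The first two fields say that the expected payments exist. -/
structure IsBIC {n : ℕ} (M : Mechanism n) (D : Fin n → Measure ℝ) : Prop where
  integrable_pay : ∀ i, Integrable (fun w => M.pay w i) (Measure.pi D)
  integrable_interim_pay : ∀ i, ∀ b : ℝ, 0 ≤ b →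
    Integrable (fun w => M.pay (Function.update w i b) i) (Measure.pi D)
  incentive_compatible : ∀ i, ∀ v b : ℝ, 0 ≤ v → 0 ≤ b →
    interimUtility M D i v b ≤ interimUtility M D i v v
  individually_rational : ∀ i, ∀ v : ℝ, 0 ≤ v → 0 ≤ interimUtility M D i v v

/-- The expected revenue of `M` on `D`. -/
def revenue {n : ℕ} (M : Mechanism n) (D : Fin n → Measure ℝ) : ℝ :=
  ∫ w, ∑ i, M.pay w i ∂(Measure.pi D)

/-- The optimal revenue: the supremum of the revenues of all Bayesian incentive compatible
mechanisms. -/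
def optRevenue {n : ℕ} (D : Fin n → Measure ℝ) : EReal :=
  ⨆ (M : Mechanism n) (_ : IsBIC M D), (revenue M D : EReal)

/-! ### Learning algorithms -/

/-- A (possibly randomized) algorithm that takes `m` sampled value profiles and a random seed from
`Ω`, and returns a mechanism. -/
structure LearningAlgorithm (n m : ℕ) (Ω : Type*) [MeasurableSpace Ω] where
  output : (Fin m → Fin n → ℝ) × Ω → Mechanism n
  measurable_alloc : ∀ i, Measurable
    fun z : ((Fin m → Fin n → ℝ) × Ω) × (Fin n → ℝ) => (output z.1).alloc z.2 i
  measurable_pay : ∀ i, Measurable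
    fun z : ((Fin m → Fin n → ℝ) × Ω) × (Fin n → ℝ) => (output z.1).pay z.2 i

/-- The joint law of `m` i.i.d. samples from the product distribution `D` and the seed. -/
def sampleLaw {n : ℕ} (m : ℕ) {Ω : Type*} [MeasurableSpace Ω] (D : Fin n → Measure ℝ)
    (P : Measure Ω) : Measure ((Fin m → Fin n → ℝ) × Ω) :=
  (Measure.pi fun _ : Fin m => Measure.pi D).prod P

/-- With probability at least `0.99`, the returned mechanism is Bayesian incentive compatible for
`D` and its revenue is at least `Opt(D) - loss`. -/
def LearnsUpTo {n m : ℕ} {Ω : Type*} [MeasurableSpace Ω] (A : LearningAlgorithm n m Ω)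
    (P : Measure Ω) (D : Fin n → Measure ℝ) (loss : ℝ) : Prop :=
  0.99 ≤ (sampleLaw m D P).real
    {z | IsBIC (A.output z) D ∧ optRevenue D - (loss : EReal) ≤ (revenue (A.output z) D : EReal)}

/-- The symmetric Kullback–Leibler divergence. -/
def sklDiv {α : Type*} [MeasurableSpace α] (P Q : Measure α) : ENNReal :=
  InformationTheory.klDiv P Q + InformationTheory.klDiv Q P

/-! ### The family of hard instances -/

/-- Bidder `0` has the base distribution, every other bidder has one of `Dh`, `Dl`. -/
def hardFamily (n : ℕ) (Db Dh Dl : Measure ℝ) : Set (Fin n → Measure ℝ) :=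
  {D | ∀ i, (i.val = 0 → D i = Db) ∧ (i.val ≠ 0 → D i = Dh ∨ D i = Dl)}

/-- The critical interval of values `v₁ > v ≥ v₂`. -/
def criticalInterval (v₁ : EReal) (v₂ : ℝ) : Set ℝ :=
  {v : ℝ | v₂ ≤ v ∧ (v : EReal) < v₁}

/-- The conditions on the base distribution `Db`, the high distribution `Dh` and the low
distribution `Dl`. Conditions on virtual values and densities concern the values of the respective
distribution, that is, they hold almost surely. -/
structure HardConditions (n : ℕ) (Db Dh Dl : Measure ℝ) (v₀ : ℝ) (v₁ : EReal) (v₂ p Δ : ℝ) :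
    Prop where
  dist_high : IsValueDistribution Dh
  dist_low : IsValueDistribution Dl
  v₀_pos : 0 < v₀
  v₁_pos : 0 < v₁
  v₂_pos : 0 < v₂
  p_pos : 0 < p
  p_le : p ≤ 1 / n
  Δ_pos : 0 < Δ
  base_pointmass : Db = Measure.dirac v₀
  prob_high_values : Dh.real (Ici v₂) ≤ 1 / n ∧ Dl.real (Ici v₂) ≤ 1 / n
  prob_critical : p ≤ Dh.real (criticalInterval v₁ v₂) ∧ p ≤ Dl.real (criticalInterval v₁ v₂)
  gap_low : ∀ᵐ v ∂Dl, v ∈ criticalInterval v₁ v₂ → virtualValue Dl v + Δ ≤ v₀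
  gap_high : ∀ᵐ v ∂Dh, v ∈ criticalInterval v₁ v₂ → v₀ ≤ virtualValue Dh v - Δ
  small_low : ∀ᵐ v ∂Dl, v < v₂ → virtualValue Dl v ≤ v₀
  small_high : ∀ᵐ v ∂Dh, v < v₂ → virtualValue Dh v ≤ v₀
  density_ac : Dl.restrict (criticalInterval v₁ v₂) ≪ Dh
  density_ratio : ∀ᵐ v ∂Dh, v ∈ criticalInterval v₁ v₂ →
    ENNReal.ofReal (1 / √2) ≤ Dl.rnDeriv Dh v ∧ Dl.rnDeriv Dh v ≤ ENNReal.ofReal √2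
  regular_high : IsRegularDistribution Dh
  v₁_top_or_pointmass : v₁ = ⊤ ∨ ∃ w : ℝ, v₁ = (w : EReal) ∧
    0 < Dh {w} ∧ 0 < Dl {w} ∧ Dh (Ioi w) = 0 ∧ Dl (Ioi w) = 0

end

/-!
The lower bound combines a revenue comparison for each product distribution in the hard family with
a two-point argument for each bidder.

*Revenue.* For bidders with a critical value `v₂ ≤ v < v₁`, the virtual value is at least `v₀ + Δ`
under the high distribution and at most `v₀ - Δ` under the low one, while all values below `v₂`, and
the base bidder, have virtual value at most `v₀`. Hence the optimum must serve a bidder who is the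
only one above `v₂` in the first case, and must not serve her in the second; a wrong decision loses
`Δ`. To make this precise, the revenue of any Bayesian incentive compatible mechanism is bounded
above by the expected virtual value it serves (`integral_pay_le`), and a mechanism that gives the
item to the highest score earns the virtual value of the winner (`le_integral_scorePay`), which is
the maximal one for suitable scores (`HardConditions.ae_virtual_regret`). Both bounds rest on one
identity, `lintegral_markdown`: the expectation of `x (V - φ V)` is an integral over the line of
the tail probability, in which an atom is spread over the gap above it. For a monotone `x` this is
at most the information rent `∫ x(t) Pr[V > t] dt`; for a regular distribution and an `x` that is
constant on the gaps, the two agree.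

The values may have infinite mean, and then the revenue can exceed the expected virtual value and
the optimum need not be attained. Both sides are therefore compared for the distributions truncated
at a threshold `B` that lies in no gap: a value of at least `B` counts as virtual value `B` for
every mechanism, and the score mechanism serves such values first. The payments that a mechanism
collects above `B` vanish as `B` exhausts the values, which gives `HardConditions.regret_le`.

*Statistics.* If the distributions of all bidders but `i` are fixed, one mechanism cannot be right
about bidder `i` under both her distributions, because these are within a factor `√2` of each other
on the critical interval, and with probability at least `1/3` all others are below `v₂`
(`HardConditions.mistakeMass_add_ge`). The chain rule for the Kullback–Leibler divergence shows that
too few samples do not tell the two instances apart (`HardConditions.badEvent_add_ge`). Averaged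
over the whole cube of instances, a constant fraction of the bidders is then decided wrongly,
whereas an algorithm that learns every instance is wrong about few of them
(`HardConditions.sum_badEvent_le`).
-/

noncomputable section

/-! ### Product measures and the Kullback–Leibler divergence -/

theorem measurable_update_uncurry {n : ℕ} (i : Fin n) :
    Measurable fun z : (Fin n → ℝ) × ℝ => Function.update z.1 i z.2 := by
  refine measurable_pi_lambda _ fun j => ?_
  by_cases h : j = i
  · subst h; simpa using measurable_snd
  · simp only [Function.update_of_ne h]
    exact (measurable_pi_apply j).comp measurable_fst

theorem isProbabilityMeasure_update {n : ℕ} (D : Fin n → Measure ℝ)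
    [∀ i, IsProbabilityMeasure (D i)] (i : Fin n) (ν : Measure ℝ) [IsProbabilityMeasure ν]
    (j : Fin n) : IsProbabilityMeasure (Function.update D i ν j) := by
  by_cases h : j = i
  · subst h; simpa
  · rw [Function.update_of_ne h]; infer_instance

/-- Resampling the `i`-th coordinate of a product measure from `ν` gives the product measure whose
`i`-th factor is `ν`. -/
theorem pi_update_eq_map {n : ℕ} (D : Fin n → Measure ℝ) [∀ i, IsProbabilityMeasure (D i)]
    (i : Fin n) (ν : Measure ℝ) [IsProbabilityMeasure ν] :
    Measure.pi (Function.update D i ν)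
      = ((Measure.pi D).prod ν).map fun z => Function.update z.1 i z.2 := by
  have := isProbabilityMeasure_update D i ν
  refine (Measure.pi_eq fun s hs => ?_)
  rw [Measure.map_apply (measurable_update_uncurry i) (MeasurableSet.univ_pi hs)]
  have : (fun z : (Fin n → ℝ) × ℝ => Function.update z.1 i z.2) ⁻¹' (univ.pi s)
      = (univ.pi (Function.update s i univ)) ×ˢ (s i) := by
    ext z
    simp only [mem_preimage, mem_pi, mem_univ, true_imp_iff, mem_prod]
    constructor
    · intro h
      refine ⟨fun j => ?_, by simpa using h i⟩
      by_cases hj : j = i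
      · subst hj; simp
      · simpa [Function.update_of_ne hj] using h j
    · rintro ⟨h, h'⟩ j
      by_cases hj : j = i
      · subst hj; simpa using h'
      · simpa [Function.update_of_ne hj] using h j
  rw [this, Measure.prod_prod, Measure.pi_pi, ← Finset.mul_prod_erase _ _ (Finset.mem_univ i),
    ← Finset.mul_prod_erase (Finset.univ) (fun j => Function.update D i ν j (s j))
      (Finset.mem_univ i)]
  simp only [Function.update_self, measure_univ, one_mul]
  rw [mul_comm]
  congr 1
  refine Finset.prod_congr rfl fun j hj => ?_
  have hj' := Finset.ne_of_mem_erase hj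
  simp [Function.update_of_ne hj']

theorem pi_eq_map_update {n : ℕ} (D : Fin n → Measure ℝ) [∀ i, IsProbabilityMeasure (D i)]
    (i : Fin n) :
    Measure.pi D = ((Measure.pi D).prod (D i)).map fun z => Function.update z.1 i z.2 := by
  conv_lhs => rw [← Function.update_eq_self i D]
  exact pi_update_eq_map D i (D i)

section KL
open InformationTheory ProbabilityTheory

variable {α β : Type*} [MeasurableSpace α] [MeasurableSpace β]

theorem klDiv_prod_right (μ ν : Measure α) (ρ : Measure β) [IsProbabilityMeasure μ]
    [IsProbabilityMeasure ν] [IsProbabilityMeasure ρ] :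
    klDiv (μ.prod ρ) (ν.prod ρ) = klDiv μ ν := by
  rw [← Measure.compProd_const, ← Measure.compProd_const, klDiv_compProd_left]

theorem klDiv_prod_left_le (ρ : Measure α) (μ ν : Measure β) [IsProbabilityMeasure μ]
    [IsProbabilityMeasure ν] [IsProbabilityMeasure ρ] :
    klDiv (ρ.prod μ) (ρ.prod ν) ≤ klDiv μ ν := by
  rw [← Measure.prod_swap (μ := μ), ← Measure.prod_swap (μ := ν)]
  exact (klDiv_map_le _ _ measurable_swap).trans (klDiv_prod_right _ _ _).le

theorem klDiv_prod_le (μ μ' : Measure α) (ν ν' : Measure β) [IsProbabilityMeasure μ]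
    [IsProbabilityMeasure ν] [IsProbabilityMeasure μ'] [IsProbabilityMeasure ν'] :
    klDiv (μ.prod ν) (μ'.prod ν') ≤ klDiv μ μ' + klDiv ν ν' := by
  have h := klDiv_compProd_eq_add μ μ' (Kernel.const α ν) (Kernel.const α ν')
  simp only [Measure.compProd_const] at h
  rw [h]
  gcongr
  exact klDiv_prod_left_le _ _ _

/-- Changing one factor of a product measure costs at most the divergence of that factor. -/
theorem klDiv_pi_update_le {n : ℕ} (D : Fin n → Measure ℝ) [∀ i, IsProbabilityMeasure (D i)]
    (i : Fin n) (μ ν : Measure ℝ) [IsProbabilityMeasure μ] [IsProbabilityMeasure ν] :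
    klDiv (Measure.pi (Function.update D i μ)) (Measure.pi (Function.update D i ν))
      ≤ klDiv μ ν := by
  rw [pi_update_eq_map D i μ, pi_update_eq_map D i ν]
  exact (klDiv_map_le _ _ (measurable_update_uncurry i)).trans (klDiv_prod_left_le _ _ _)

theorem klDiv_pi_const_le (m : ℕ) (μ ν : Measure α) [IsProbabilityMeasure μ]
    [IsProbabilityMeasure ν] :
    klDiv (Measure.pi fun _ : Fin m => μ) (Measure.pi fun _ : Fin m => ν) ≤ m * klDiv μ ν := by
  induction m with
  | zero =>
    rw [Measure.pi_of_empty, Measure.pi_of_empty]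
    simp
  | succ m ih =>
    have h1 := (measurePreserving_piFinSuccAbove (fun _ : Fin (m + 1) => μ) 0).symm
    have h2 := (measurePreserving_piFinSuccAbove (fun _ : Fin (m + 1) => ν) 0).symm
    rw [← h1.map_eq, ← h2.map_eq]
    refine (klDiv_map_le _ _ (MeasurableEquiv.measurable _)).trans ?_
    refine (klDiv_prod_le _ _ _ _).trans ?_
    rw [add_comm]
    push_cast
    rw [add_mul, one_mul]
    gcongr

/-- The laws of the samples drawn from two product distributions that differ in one factor have
divergence at most `m` times the divergence of that factor. -/
theorem klDiv_sampleLaw_update_le {n : ℕ} (m : ℕ) {Ω : Type*} [MeasurableSpace Ω]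
    (P : Measure Ω) [IsProbabilityMeasure P] (D : Fin n → Measure ℝ)
    [∀ i, IsProbabilityMeasure (D i)] (i : Fin n) (μ ν : Measure ℝ) [IsProbabilityMeasure μ]
    [IsProbabilityMeasure ν] :
    klDiv (sampleLaw m (Function.update D i μ) P) (sampleLaw m (Function.update D i ν) P)
      ≤ m * klDiv μ ν := by
  have := isProbabilityMeasure_update D i μ
  have := isProbabilityMeasure_update D i ν
  unfold sampleLaw
  rw [klDiv_prod_right]
  refine (klDiv_pi_const_le _ _ _).trans ?_
  gcongr
  exact klDiv_pi_update_le _ _ _ _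

/-- Two laws of small divergence assign similar probabilities to every event. The proof integrates
Young's inequality `x t ≤ klFun x + (exp t - 1)` at `t = 1/4` over the event. -/
theorem measureReal_le_add_half_of_klDiv_le (μ ν : Measure α) [IsProbabilityMeasure μ]
    [IsProbabilityMeasure ν] (h : klDiv μ ν ≤ ENNReal.ofReal (1 / 16)) {E : Set α}
    (hE : MeasurableSet E) : μ.real E ≤ ν.real E + 1 / 2 := by
  have hne : klDiv μ ν ≠ ⊤ := ne_top_of_le_ne_top ENNReal.ofReal_ne_top h
  obtain ⟨hac, -⟩ := klDiv_ne_top_iff.mp hne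
  have young : ∀ x : ℝ, 0 ≤ x → x * (1 / 4) ≤ klFun x + 5 / 16 := by
    intro x hx
    have hexp : Real.exp (1 / 4) ≤ 21 / 16 := by
      have := Real.abs_exp_sub_one_sub_id_le (x := 1 / 4) (by norm_num [abs_of_pos])
      have := (abs_le.mp this).2
      linarith
    rcases hx.eq_or_lt with rfl | hx
    · simp [klFun]; norm_num
    · have h1 := Real.add_one_le_exp (1 / 4 - Real.log x)
      rw [Real.exp_sub, Real.exp_log hx, le_div_iff₀ hx] at h1
      rw [klFun_apply]
      linarith
  have key : ENNReal.ofReal (1 / 4) * μ E ≤ ENNReal.ofReal (1 / 16)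
      + ENNReal.ofReal (5 / 16) * ν E := by
    have hμE : μ E = ∫⁻ x in E, ENNReal.ofReal (μ.rnDeriv ν x).toReal ∂ν := by
      conv_lhs => rw [← Measure.withDensity_rnDeriv_eq μ ν hac, withDensity_apply _ hE]
      refine lintegral_congr_ae (ae_restrict_of_ae ?_)
      filter_upwards [μ.rnDeriv_ne_top ν] with x hx
      rw [ENNReal.ofReal_toReal hx]
    calc ENNReal.ofReal (1 / 4) * μ E
        = ∫⁻ x in E, ENNReal.ofReal ((μ.rnDeriv ν x).toReal * (1 / 4)) ∂ν := by
          rw [hμE, ← lintegral_const_mul _ (by fun_prop)]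
          refine lintegral_congr fun x => ?_
          rw [← ENNReal.ofReal_mul (by norm_num), mul_comm]
      _ ≤ ∫⁻ x in E, (ENNReal.ofReal (klFun (μ.rnDeriv ν x).toReal)
            + ENNReal.ofReal (5 / 16)) ∂ν := by
          refine lintegral_mono fun x => ?_
          exact (ENNReal.ofReal_le_ofReal (young _ ENNReal.toReal_nonneg)).trans
            ENNReal.ofReal_add_le
      _ = ∫⁻ x in E, ENNReal.ofReal (klFun (μ.rnDeriv ν x).toReal) ∂ν
            + ENNReal.ofReal (5 / 16) * ν E := by
          rw [lintegral_add_right _ measurable_const]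
          simp
      _ ≤ _ := by
          gcongr
          refine le_trans (setLIntegral_le_lintegral _ _) ?_
          rwa [← klDiv_eq_lintegral_klFun_of_ac hac]
  have key' := ENNReal.toReal_mono (by finiteness) key
  rw [ENNReal.toReal_add (by finiteness) (by finiteness), ENNReal.toReal_mul, ENNReal.toReal_mul,
    ENNReal.toReal_ofReal (by norm_num), ENNReal.toReal_ofReal (by norm_num),
    ENNReal.toReal_ofReal (by norm_num)] at key'
  have hν : ν.real E ≤ 1 := measureReal_le_one
  simp only [measureReal_def] at *
  linarith

end KL

/-! ### Virtual values and the distribution of mass -/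

/-- The atoms of a measure on the line. -/
def atoms (D : Measure ℝ) : Set ℝ := {a | D {a} ≠ 0}

/-- The difference `v - φ(v)` between value and virtual value. -/
def markdown (D : Measure ℝ) (v : ℝ) : ℝ := v - virtualValue D v

theorem countable_atoms (D : Measure ℝ) [IsFiniteMeasure D] : (atoms D).Countable := by
  have h := Measure.countable_meas_pos_of_disjoint_iUnion (μ := D)
    (As := fun a : ℝ => ({a} : Set ℝ))
    (fun a => measurableSet_singleton a)
    (fun a b hab => by simpa [Function.onFun] using hab)
  simpa [atoms, pos_iff_ne_zero] using h

theorem measurable_measure_Ioi (D : Measure ℝ) : Measurable fun t => D (Ioi t) :=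
  Antitone.measurable fun _ _ h => measure_mono (Ioi_subset_Ioi h)

theorem measurable_virtualValue (D : Measure ℝ) [IsFiniteMeasure D] :
    Measurable (virtualValue D) := by
  have h : Measurable fun v => v - D.real (Ioi v) / (D.rnDeriv volume v).toReal := by
    have := (measurable_measure_Ioi D).ennreal_toReal
    have h2 := (D.measurable_rnDeriv volume).ennreal_toReal
    exact measurable_id.sub (this.div h2)
  refine h.measurable_of_countable_ne ((countable_atoms D).mono fun v hv => ?_)
  by_contra hcon
  have h0 : D {v} = 0 := by simpa [atoms] using hcon
  exact hv (by simp [virtualValue, h0])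

theorem measurable_markdown (D : Measure ℝ) [IsFiniteMeasure D] : Measurable (markdown D) :=
  measurable_id.sub (measurable_virtualValue D)

section NextValue

variable {D : Measure ℝ} {a t : ℝ}

theorem bddBelow_nextValue_set : BddBelow {w : ℝ | a < w ∧ 0 < D (Ioc a w)} :=
  ⟨a, fun _ hw => hw.1.le⟩

theorem nonempty_nextValue_set (h : D (Ioi a) ≠ 0) :
    {w : ℝ | a < w ∧ 0 < D (Ioc a w)}.Nonempty := by
  by_contra hcon
  apply h
  have : Ioi a = ⋃ k : ℕ, Ioc a (a + (k + 1)) := by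
    ext w
    simp only [mem_Ioi, mem_iUnion, mem_Ioc]
    constructor
    · intro hw
      obtain ⟨k, hk⟩ := exists_nat_ge (w - a)
      exact ⟨k, hw, by linarith⟩
    · rintro ⟨k, hk, -⟩
      exact hk
  rw [this]
  refine measure_iUnion_null fun k => ?_
  by_contra hk
  exact hcon ⟨a + (k + 1), by have : (0 : ℝ) ≤ k := k.cast_nonneg; linarith,
    pos_iff_ne_zero.mpr hk⟩

theorem le_nextValue (h : D (Ioi a) ≠ 0) : a ≤ nextValue D a :=
  le_csInf (nonempty_nextValue_set h) fun _ hw => hw.1.le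

theorem measure_Ioc_eq_zero_of_lt_nextValue (ht : t < nextValue D a) : D (Ioc a t) = 0 := by
  by_cases hat : a < t
  · by_contra hcon
    exact absurd (csInf_le bddBelow_nextValue_set ⟨hat, pos_iff_ne_zero.mpr hcon⟩) (not_le.mpr ht)
  · simp [Ioc_eq_empty hat]

theorem le_nextValue_of_measure_Ioc_eq_zero (h : D (Ioi a) ≠ 0) (ht : D (Ioc a t) = 0) :
    t ≤ nextValue D a := by
  refine le_csInf (nonempty_nextValue_set h) fun w hw => ?_
  by_contra hcon
  exact absurd (measure_mono_null (Ioc_subset_Ioc_right (not_le.mp hcon).le) ht) hw.2.ne'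

theorem measure_Ioo_nextValue : D (Ioo a (nextValue D a)) = 0 := by
  have : Ioo a (nextValue D a) ⊆ ⋃ q : {q : ℚ // (q : ℝ) < nextValue D a}, Ioc a (q : ℝ) := by
    intro t ht
    obtain ⟨q, hq1, hq2⟩ := exists_rat_btwn ht.2
    exact mem_iUnion.mpr ⟨⟨q, hq2⟩, ht.1, hq1.le⟩
  refine measure_mono_null this (measure_iUnion_null fun q => ?_)
  exact measure_Ioc_eq_zero_of_lt_nextValue q.2

theorem measure_Ioi_eq_of_mem_gap (h1 : a < t) (h2 : t < nextValue D a) :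
    D (Ioi t) = D (Ioi a) := by
  refine le_antisymm (measure_mono (Ioi_subset_Ioi h1.le)) ?_
  rw [← Ioc_union_Ioi_eq_Ioi h1.le]
  refine (measure_union_le _ _).trans ?_
  rw [measure_Ioc_eq_zero_of_lt_nextValue h2, zero_add]

end NextValue

theorem markdown_nonneg (D : Measure ℝ) (v : ℝ) : 0 ≤ markdown D v := by
  unfold markdown virtualValue
  split_ifs with h
  · have : v - (v - (nextValue D v - v) * (D.real (Ioi v) / D.real {v}))
      = (nextValue D v - v) * (D.real (Ioi v) / D.real {v}) := by ring
    rw [this]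
    by_cases h0 : D (Ioi v) = 0
    · simp [measureReal_def, h0]
    · exact mul_nonneg (by linarith [le_nextValue h0]) (by positivity)
  · have : v - (v - D.real (Ioi v) / (D.rnDeriv volume v).toReal)
      = D.real (Ioi v) / (D.rnDeriv volume v).toReal := by ring
    rw [this]
    positivity

theorem virtualValue_le_self (D : Measure ℝ) (v : ℝ) : virtualValue D v ≤ v := by
  have := markdown_nonneg D v
  unfold markdown at this
  linarith

theorem ae_rnDeriv_eq_zero_of_measure_eq_zero (D : Measure ℝ) {s : Set ℝ} (hs : MeasurableSet s)
    (h : D s = 0) : ∀ᵐ t : ℝ, t ∈ s → D.rnDeriv volume t = 0 := by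
  have h1 : ∫⁻ t in s, D.rnDeriv volume t = 0 :=
    le_antisymm ((Measure.setLIntegral_rnDeriv_le s).trans h.le) zero_le
  rw [lintegral_eq_zero_iff (D.measurable_rnDeriv volume)] at h1
  exact (ae_restrict_iff' hs).mp h1

/-- Away from its atoms, a value distribution has the density `D.rnDeriv volume`. -/
theorem restrict_compl_atoms_eq_withDensity {D : Measure ℝ} (hD : IsValueDistribution D) :
    D.restrict (atoms D)ᶜ = volume.withDensity (D.rnDeriv volume) := by
  have := hD.prob
  have hA := countable_atoms D
  have hac : D.restrict (atoms D)ᶜ ≪ volume := by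
    obtain ⟨S, hS, hSac⟩ := hD.mixture
    refine Measure.AbsolutelyContinuous.mk fun N hN hN0 => ?_
    rw [Measure.restrict_apply hN]
    have hsub : N ∩ (atoms D)ᶜ ⊆ (N ∩ Sᶜ) ∪ (S ∩ (atoms D)ᶜ) := by
      intro v hv
      by_cases hvS : v ∈ S
      · exact Or.inr ⟨hvS, hv.2⟩
      · exact Or.inl ⟨hv.1, hvS⟩
    refine measure_mono_null hsub (measure_union_null ?_ ?_)
    · have := hSac hN0
      rwa [Measure.restrict_apply hN] at this
    · have hc : (S ∩ (atoms D)ᶜ).Countable := hS.mono inter_subset_left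
      refine (measure_null_iff_singleton hc).mpr fun v hv => ?_
      simpa [atoms] using hv.2
  rw [← Measure.withDensity_rnDeriv_eq _ _ hac]
  refine withDensity_congr_ae ?_
  refine (Measure.rnDeriv_restrict D volume hA.measurableSet.compl).trans ?_
  have h0 : ∀ᵐ t : ℝ, t ∉ atoms D := by
    rw [ae_iff]
    simpa using hA.measure_zero volume
  filter_upwards [h0] with t ht
  simp [indicator, ht]

open Classical in
/-- The weight with which the point `t` contributes to the integral of `x` times the markdown:
each atom `a` spreads `x a` over the gap between `a` and the next value, and the points of positive
density contribute `x t`. -/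
def markdownWeight (D : Measure ℝ) (B : ℝ) (x : ℝ → ENNReal) (t : ℝ) : ENNReal :=
  (∑' a : atoms D, if (a : ℝ) < B then
      (Ioo (a : ℝ) (nextValue D a)).indicator (fun _ => x a) t else 0)
    + (Iio B ∩ {t | D.rnDeriv volume t ≠ 0}).indicator x t

/-- The expected markdown is an integral over the line of the tail probability. -/
theorem lintegral_markdown {D : Measure ℝ} (hD : IsValueDistribution D) {x : ℝ → ENNReal}
    (hx : Measurable x) (B : ℝ) :
    ∫⁻ v in Iio B, x v * ENNReal.ofReal (markdown D v) ∂D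
      = ∫⁻ t, markdownWeight D B x t * D (Ioi t) := by
  classical
  have := hD.prob
  have hA := countable_atoms D
  have : Countable (atoms D) := hA.to_subtype
  have hmg : Measurable fun v => x v * ENNReal.ofReal (markdown D v) :=
    hx.mul (measurable_markdown D).ennreal_ofReal
  have htail := measurable_measure_Ioi D
  have hf := D.measurable_rnDeriv volume
  have hset : MeasurableSet (Iio B ∩ {t | D.rnDeriv volume t ≠ 0}) :=
    measurableSet_Iio.inter (hf (measurableSet_singleton 0).compl)
  have hterm : ∀ a : atoms D, Measurable fun t =>
      if (a : ℝ) < B then (Ioo (a : ℝ) (nextValue D a)).indicator (fun _ => x a) t else 0 := by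
    intro a
    split_ifs
    · exact measurable_const.indicator measurableSet_Ioo
    · exact measurable_const
  have hsplit : ∫⁻ t, markdownWeight D B x t * D (Ioi t)
      = (∑' a : atoms D, ∫⁻ t, (if (a : ℝ) < B then
          (Ioo (a : ℝ) (nextValue D a)).indicator (fun _ => x a) t else 0) * D (Ioi t))
        + ∫⁻ t, (Iio B ∩ {t | D.rnDeriv volume t ≠ 0}).indicator x t * D (Ioi t) := by
    simp_rw [markdownWeight, add_mul]
    have hs : Measurable fun t => ∑' a : atoms D, if (a : ℝ) < B then
      (Ioo (a : ℝ) (nextValue D a)).indicator (fun _ => x a) t else 0 := Measurable.tsum hterm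
    have hm := hs.mul htail
    rw [lintegral_add_left (f := fun t => (∑' a : atoms D, if (a : ℝ) < B then
      (Ioo (a : ℝ) (nextValue D a)).indicator (fun _ => x a) t else 0) * D (Ioi t)) hm]
    congr 1
    simp_rw [← ENNReal.tsum_mul_right]
    exact lintegral_tsum fun a => ((hterm a).mul htail).aemeasurable
  rw [hsplit, ← lintegral_indicator measurableSet_Iio, ← lintegral_add_compl _ hA.measurableSet]
  congr 1
  · rw [lintegral_countable _ hA]
    refine tsum_congr fun a => ?_
    have ha : D {(a : ℝ)} ≠ 0 := a.2
    by_cases haB : (a : ℝ) < B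
    · simp only [haB, if_true]
      have h1 : ∀ t, (Ioo (a : ℝ) (nextValue D a)).indicator (fun _ => x a) t * D (Ioi t)
          = (Ioo (a : ℝ) (nextValue D a)).indicator (fun _ => x a * D (Ioi (a : ℝ))) t := by
        intro t
        by_cases ht : t ∈ Ioo (a : ℝ) (nextValue D a)
        · rw [indicator_of_mem ht, indicator_of_mem ht, measure_Ioi_eq_of_mem_gap ht.1 ht.2]
        · rw [indicator_of_notMem ht, indicator_of_notMem ht, zero_mul]
      simp_rw [h1]
      rw [lintegral_indicator measurableSet_Ioo, setLIntegral_const, Real.volume_Ioo,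
        indicator_of_mem (by exact haB)]
      have h2 : markdown D a
          = (nextValue D a - a) * (D.real (Ioi (a : ℝ)) / D.real {(a : ℝ)}) := by
        simp [markdown, virtualValue, ha]
      rw [h2, mul_assoc, mul_assoc]
      congr 1
      by_cases h0 : D (Ioi (a : ℝ)) = 0
      · simp [measureReal_def, h0]
      · rw [ENNReal.ofReal_mul (by linarith [le_nextValue h0]), mul_comm (D (Ioi (a : ℝ))),
          mul_assoc]
        congr 1
        have hpos : 0 < D.real {(a : ℝ)} := ENNReal.toReal_pos ha (measure_ne_top _ _)
        rw [ENNReal.ofReal_div_of_pos hpos,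
          ofReal_measureReal, ofReal_measureReal]
        exact ENNReal.div_mul_cancel ha (measure_ne_top _ _)
    · simp [haB]
  · rw [restrict_compl_atoms_eq_withDensity hD,
      lintegral_withDensity_eq_lintegral_mul _ hf (hmg.indicator measurableSet_Iio)]
    have h0 : ∀ᵐ t : ℝ, t ∉ atoms D := by
      rw [ae_iff]
      simpa using hA.measure_zero volume
    refine lintegral_congr_ae ?_
    filter_upwards [h0, D.rnDeriv_ne_top volume] with t ht hft
    have ht' : D {t} = 0 := by simpa [atoms] using ht
    simp only [Pi.mul_apply]
    by_cases htB : t < B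
    · by_cases hf0 : D.rnDeriv volume t = 0
      · simp [hf0]
      · rw [indicator_of_mem (by exact htB), indicator_of_mem (by exact ⟨htB, hf0⟩)]
        have h2 : markdown D t = D.real (Ioi t) / (D.rnDeriv volume t).toReal := by
          simp [markdown, virtualValue, ht']
        rw [h2, ENNReal.ofReal_div_of_pos (ENNReal.toReal_pos hf0 hft), ofReal_measureReal,
          ENNReal.ofReal_toReal hft, mul_left_comm, ENNReal.mul_div_cancel hf0 hft]
    · simp [htB]

/-- No gap of `D` between an atom and the next value extends beyond `B`. -/
def NoGapAcross (D : Measure ℝ) (B : ℝ) : Prop :=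
  ∀ a < B, D {a} ≠ 0 → D (Ioi a) ≠ 0 → nextValue D a ≤ B

/-- For a monotone allocation, the information rent below `B` is at least the expected markdown. -/
theorem lintegral_markdown_le {D : Measure ℝ} (hD : IsValueDistribution D) {B : ℝ}
    (hB : NoGapAcross D B) {x : ℝ → ENNReal} (hx : Monotone x) :
    ∫⁻ v in Iio B, x v * ENNReal.ofReal (markdown D v) ∂D
      ≤ ∫⁻ t in Ioo 0 B, x t * D (Ioi t) := by
  classical
  have := hD.prob
  have hA := countable_atoms D
  have : Countable (atoms D) := hA.to_subtype
  rw [lintegral_markdown hD hx.measurable, ← lintegral_indicator measurableSet_Ioo]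
  have hgap : ∀ᵐ t : ℝ, ∀ a : atoms D, t ∈ Ioo (a : ℝ) (nextValue D a) →
      D.rnDeriv volume t = 0 :=
    ae_all_iff.mpr fun a => ae_rnDeriv_eq_zero_of_measure_eq_zero D measurableSet_Ioo
      measure_Ioo_nextValue
  have hneg := ae_rnDeriv_eq_zero_of_measure_eq_zero D measurableSet_Iio hD.nonneg
  have hzero : ∀ᵐ t : ℝ, t ≠ 0 := by simp [ae_iff]
  refine lintegral_mono_ae ?_
  filter_upwards [hgap, hneg, hzero] with t ht1 ht2 ht3
  by_cases h0 : D (Ioi t) = 0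
  · simp [h0]
  by_cases hex : ∃ a : atoms D, (a : ℝ) < B ∧ t ∈ Ioo (a : ℝ) (nextValue D a)
  · obtain ⟨a, haB, hat⟩ := hex
    have hDa : D (Ioi (a : ℝ)) ≠ 0 := by rwa [← measure_Ioi_eq_of_mem_gap hat.1 hat.2]
    have ha0 : 0 ≤ (a : ℝ) := by
      by_contra hcon
      exact a.2 (measure_mono_null
        (singleton_subset_iff.mpr (show (a : ℝ) ∈ Iio 0 from not_le.mp hcon)) hD.nonneg)
    have htB : t < B := hat.2.trans_le (hB a haB a.2 hDa)
    have hw : markdownWeight D B x t = x a := by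
      unfold markdownWeight
      have h2 : (Iio B ∩ {t | D.rnDeriv volume t ≠ 0}).indicator x t = 0 :=
        indicator_of_notMem (fun h => h.2 (ht1 a hat)) _
      rw [tsum_eq_single a, h2, add_zero, if_pos haB, indicator_of_mem hat]
      · -- a second gap through `t` would have an atom inside the first one
        intro b hb
        split_ifs with hbB
        · refine indicator_of_notMem (fun hbt => ?_) _
          rcases lt_trichotomy (a : ℝ) b with h | h | h
          · exact b.2 (measure_mono_null
              (singleton_subset_iff.mpr
              (show (b : ℝ) ∈ Ioo (a : ℝ) (nextValue D a) from ⟨h, hbt.1.trans hat.2⟩))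
              measure_Ioo_nextValue)
          · exact hb (Subtype.ext h.symm)
          · exact a.2 (measure_mono_null
              (singleton_subset_iff.mpr
              (show (a : ℝ) ∈ Ioo (b : ℝ) (nextValue D b) from ⟨h, hat.1.trans hbt.2⟩))
              measure_Ioo_nextValue)
        · rfl
    rw [hw, indicator_of_mem (show t ∈ Ioo 0 B from ⟨ha0.trans_lt hat.1, htB⟩)]
    gcongr
    exact hx hat.1.le
  · have hw : markdownWeight D B x t = (Iio B ∩ {t | D.rnDeriv volume t ≠ 0}).indicator x t := by
      unfold markdownWeight
      rw [ENNReal.tsum_eq_zero.mpr, zero_add]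
      intro a
      split_ifs with haB
      · exact indicator_of_notMem (fun h => hex ⟨a, haB, h⟩) _
      · rfl
    rw [hw]
    by_cases hm : t ∈ Iio B ∩ {t | D.rnDeriv volume t ≠ 0}
    · have htpos : 0 < t := lt_of_le_of_ne (not_lt.mp fun h => hm.2 (ht2 h)) ht3.symm
      rw [indicator_of_mem hm, indicator_of_mem (show t ∈ Ioo 0 B from ⟨htpos, hm.1⟩)]
    · simp [indicator_of_notMem hm]

/-- For a regular distribution and an allocation that is constant on the gaps of the distribution
and vanishes below it, the information rent is at most the expected markdown. -/
theorem le_lintegral_markdown {D : Measure ℝ} (hD : IsValueDistribution D)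
    (hreg : IsRegularDistribution D) {B : ℝ} {x : ℝ → ENNReal} (hx : Measurable x)
    (hgap : ∀ a t, a < t → t < B → D {a} ≠ 0 → D (Ioc a t) = 0 → x t ≤ x a)
    (hlow : ∀ t, D (Iio t) = 0 → t < B → x t = 0) :
    ∫⁻ t in Ioo 0 B, x t * D (Ioi t)
      ≤ ∫⁻ v in Iio B, x v * ENNReal.ofReal (markdown D v) ∂D := by
  classical
  have := hD.prob
  have hA := countable_atoms D
  have : Countable (atoms D) := hA.to_subtype
  rw [lintegral_markdown hD hx, ← lintegral_indicator measurableSet_Ioo]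
  have hend : ∀ᵐ t : ℝ, ∀ a : atoms D, t ≠ nextValue D a :=
    ae_all_iff.mpr fun a => by simp [ae_iff]
  refine lintegral_mono_ae ?_
  filter_upwards [hreg.positive_density, hend] with t ht1 ht2
  by_cases htm : t ∈ Ioo 0 B
  swap
  · simp [indicator_of_notMem htm]
  rw [indicator_of_mem htm]
  by_cases h0 : D (Ioi t) = 0
  · simp [h0]
  by_cases h1 : D (Iio t) = 0
  · simp [hlow t h1 htm.2]
  gcongr
  rcases ht1 (pos_iff_ne_zero.mpr h1) (pos_iff_ne_zero.mpr h0) with h | ⟨a, hat, ha, hDat⟩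
  · unfold markdownWeight
    rw [indicator_of_mem (show t ∈ Iio B ∩ {t | D.rnDeriv volume t ≠ 0} from ⟨htm.2, h⟩)]
    exact le_add_self
  · have hDa : D (Ioi a) ≠ 0 := fun h => h0 (measure_mono_null (Ioi_subset_Ioi hat.le) h)
    have hlt : t < nextValue D a := lt_of_le_of_ne
      (le_nextValue_of_measure_Ioc_eq_zero hDa hDat) (ht2 ⟨a, ha.ne'⟩)
    refine (hgap a t hat htm.2 ha.ne' hDat).trans ?_
    unfold markdownWeight
    refine le_trans ?_ le_self_add
    refine le_trans ?_ (ENNReal.le_tsum ⟨a, ha.ne'⟩)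
    simp [hat.trans htm.2, indicator_of_mem (show t ∈ Ioo a (nextValue D a) from ⟨hat, hlt⟩)]

/-- Tonelli's theorem for the information rent. -/
theorem lintegral_lintegral_Ioo_min (D : Measure ℝ) [IsFiniteMeasure D] {x : ℝ → ENNReal}
    (hx : Measurable x) (B : ℝ) :
    ∫⁻ v, (∫⁻ t in Ioo 0 (min v B), x t) ∂D = ∫⁻ t in Ioo 0 B, x t * D (Ioi t) := by
  have h1 : ∀ v, ∫⁻ t in Ioo 0 (min v B), x t
      = ∫⁻ t in Ioo 0 B, {z : ℝ × ℝ | z.2 < z.1}.indicator (fun z => x z.2) (v, t) := by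
    intro v
    rw [← lintegral_indicator measurableSet_Ioo, ← lintegral_indicator measurableSet_Ioo]
    refine lintegral_congr fun t => ?_
    simp only [indicator, mem_Ioo, lt_min_iff, mem_ofPred_eq]
    split_ifs <;> first | rfl | (exfalso; tauto)
  rw [lintegral_congr h1]
  have hm : Measurable ({z : ℝ × ℝ | z.2 < z.1}.indicator fun z => x z.2) :=
    (hx.comp measurable_snd).indicator (measurableSet_lt measurable_snd measurable_fst)
  rw [lintegral_lintegral_swap (f := fun v t => {z : ℝ × ℝ | z.2 < z.1}.indicator
    (fun z => x z.2) (v, t)) hm.aemeasurable]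
  refine lintegral_congr fun t => ?_
  have : ∀ v, {z : ℝ × ℝ | z.2 < z.1}.indicator (fun z => x z.2) (v, t)
      = (Ioi t).indicator (fun _ => x t) v := fun v => by simp [indicator]
  refine (lintegral_congr this).trans ?_
  rw [lintegral_indicator measurableSet_Ioi, setLIntegral_const]

/-! ### Truncated virtual values and the information rent -/

/-- The virtual value of the distribution truncated at `B`: values of at least `B` count as `B`.
The truncation makes everything integrable, also when the values have infinite mean. -/
def truncVirtualValue (D : Measure ℝ) (B v : ℝ) : ℝ :=
  if v < B then virtualValue D v else B

/-- The information rent `∫₀ᵛ x` of the allocation rule `x` at the value `v`. -/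
def rent (x : ℝ → ℝ) (v : ℝ) : ℝ := ∫ t in Ioo 0 v, x t

section Rent

variable {x : ℝ → ℝ} (hx : Measurable x) (h0 : ∀ t, 0 ≤ x t) (h1 : ∀ t, x t ≤ 1)
include hx h0 h1

theorem integrableOn_Ioo_of_mem_unit (a b : ℝ) : IntegrableOn x (Ioo a b) := by
  refine Integrable.mono' (g := fun _ => (1 : ℝ)) (by simp) hx.aestronglyMeasurable ?_
  refine Filter.Eventually.of_forall fun t => ?_
  rw [Real.norm_eq_abs, abs_of_nonneg (h0 t)]
  exact h1 t

theorem ofReal_rent (v : ℝ) :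
    ENNReal.ofReal (rent x v) = ∫⁻ t in Ioo 0 v, ENNReal.ofReal (x t) :=
  ofReal_integral_eq_lintegral_ofReal (integrableOn_Ioo_of_mem_unit hx h0 h1 0 v)
    (Filter.Eventually.of_forall h0)

omit hx h1 in
theorem rent_nonneg (v : ℝ) : 0 ≤ rent x v :=
  integral_nonneg h0

theorem rent_mono : Monotone (rent x) := fun _ _ hvw =>
  setIntegral_mono_set (integrableOn_Ioo_of_mem_unit hx h0 h1 _ _) (Filter.Eventually.of_forall h0)
    (Ioo_subset_Ioo_right hvw).eventuallyLE

theorem rent_le {v : ℝ} (hv : 0 ≤ v) : rent x v ≤ v := by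
  have : rent x v ≤ ∫ _ in Ioo (0 : ℝ) v, (1 : ℝ) :=
    setIntegral_mono (integrableOn_Ioo_of_mem_unit hx h0 h1 _ _) (by simp) h1
  simpa [hv] using this

theorem integrable_rent_min (D : Measure ℝ) [IsFiniteMeasure D] {B : ℝ} (hB : 0 ≤ B) :
    Integrable (fun v => rent x (min v B)) D := by
  refine Integrable.mono' (g := fun _ => B) (integrable_const _) ?_ ?_
  · exact ((rent_mono hx h0 h1).measurable.comp
      (measurable_id.min measurable_const)).aestronglyMeasurable
  · refine Filter.Eventually.of_forall fun v => ?_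
    rw [Real.norm_eq_abs, abs_of_nonneg (rent_nonneg h0 _)]
    exact (rent_mono hx h0 h1 (min_le_right v B)).trans (rent_le hx h0 h1 hB)

theorem ofReal_integral_rent_min (D : Measure ℝ) [IsFiniteMeasure D] {B : ℝ} (hB : 0 ≤ B) :
    ENNReal.ofReal (∫ v, rent x (min v B) ∂D)
      = ∫⁻ t in Ioo 0 B, ENNReal.ofReal (x t) * D (Ioi t) := by
  rw [ofReal_integral_eq_lintegral_ofReal (integrable_rent_min hx h0 h1 D hB)
    (Filter.Eventually.of_forall fun v => rent_nonneg h0 _),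
    ← lintegral_lintegral_Ioo_min D hx.ennreal_ofReal B]
  exact lintegral_congr fun v => ofReal_rent hx h0 h1 _

end Rent

theorem ae_nonneg_of_isValueDistribution {D : Measure ℝ} (hD : IsValueDistribution D) :
    ∀ᵐ v ∂D, 0 ≤ v := by
  rw [ae_iff]
  simpa [not_le, Iio_def] using hD.nonneg

theorem integrable_min {D : Measure ℝ} (hD : IsValueDistribution D) {B : ℝ} (hB : 0 ≤ B) :
    Integrable (fun v => min v B) D := by
  have := hD.prob
  refine Integrable.mono' (g := fun _ => B) (integrable_const _)
    (measurable_id.min measurable_const).aestronglyMeasurable ?_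
  filter_upwards [ae_nonneg_of_isValueDistribution hD] with v hv
  rw [Real.norm_eq_abs, abs_of_nonneg (le_min hv hB)]
  exact min_le_right _ _

theorem truncVirtualValue_eq (D : Measure ℝ) (B v : ℝ) :
    truncVirtualValue D B v = min v B - (Iio B).indicator (markdown D) v := by
  unfold truncVirtualValue
  split_ifs with h
  · rw [indicator_of_mem (by exact h), min_eq_left h.le]; simp [markdown]
  · rw [indicator_of_notMem (by exact h), min_eq_right (not_lt.mp h), sub_zero]

theorem integrable_indicator_markdown {D : Measure ℝ} (hD : IsValueDistribution D) {B : ℝ}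
    (hB : NoGapAcross D B) : Integrable ((Iio B).indicator (markdown D)) D := by
  have := hD.prob
  have hm : Measurable ((Iio B).indicator (markdown D)) :=
    (measurable_markdown D).indicator measurableSet_Iio
  refine ⟨hm.aestronglyMeasurable, ?_⟩
  have hnn : ∀ v, 0 ≤ (Iio B).indicator (markdown D) v :=
    fun v => indicator_nonneg (fun v _ => markdown_nonneg D v) v
  rw [hasFiniteIntegral_iff_ofReal (Filter.Eventually.of_forall hnn)]
  have h := lintegral_markdown_le hD hB (x := fun _ => 1) monotone_const
  have h2 : ∫⁻ t in Ioo 0 B, 1 * D (Ioi t) ≤ ∫⁻ _ in Ioo (0 : ℝ) B, 1 :=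
    lintegral_mono fun t => by rw [one_mul]; exact prob_le_one
  rw [setLIntegral_const, Real.volume_Ioo, one_mul] at h2
  refine lt_of_le_of_lt ?_ (lt_of_le_of_lt (h.trans h2) ENNReal.ofReal_lt_top)
  rw [← lintegral_indicator measurableSet_Iio]
  refine lintegral_mono fun v => ?_
  by_cases hv : v ∈ Iio B
  · simp [hv]
  · simp [hv]

theorem integrable_truncVirtualValue {D : Measure ℝ} (hD : IsValueDistribution D) {B : ℝ}
    (hB0 : 0 ≤ B) (hB : NoGapAcross D B) : Integrable (truncVirtualValue D B) D := by
  rw [show truncVirtualValue D B = fun v => min v B - (Iio B).indicator (markdown D) v from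
    funext (truncVirtualValue_eq D B)]
  exact (integrable_min hD hB0).sub (integrable_indicator_markdown hD hB)

section Comparison

variable {D : Measure ℝ} (hD : IsValueDistribution D) {B : ℝ} (hB0 : 0 ≤ B)
  (hB : NoGapAcross D B) {x : ℝ → ℝ} (hx : Measurable x) (h0 : ∀ t, 0 ≤ x t) (h1 : ∀ t, x t ≤ 1)
include hD hB0 hB hx h0 h1

omit hB hB0 hD in
theorem integrable_mul_of_mem_unit {f : ℝ → ℝ} (hf : Integrable f D) :
    Integrable (fun v => f v * x v) D := by
  refine hf.mul_bdd (c := 1) hx.aestronglyMeasurable (Filter.Eventually.of_forall fun v => ?_)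
  rw [Real.norm_eq_abs, abs_of_nonneg (h0 v)]
  exact h1 v

/-- The expected truncated payment is the expected truncated virtual value served, up to the
difference between the expected markdown and the expected information rent. -/
theorem integral_payment_sub_eq :
    ∫ v, (min v B * x v - rent x (min v B)) ∂D
      = ∫ v, truncVirtualValue D B v * x v ∂D
        + ((∫ v, (Iio B).indicator (markdown D) v * x v ∂D) - ∫ v, rent x (min v B) ∂D) := by
  have := hD.prob
  have i1 := integrable_mul_of_mem_unit hx h0 h1 (integrable_min hD hB0)
  have i2 := integrable_mul_of_mem_unit hx h0 h1 (integrable_indicator_markdown hD hB)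
  have i3 := integrable_rent_min hx h0 h1 D hB0
  simp_rw [truncVirtualValue_eq, sub_mul]
  rw [integral_sub i1 i3, integral_sub i1 i2]
  ring

omit hB0 in
theorem ofReal_integral_markdown :
    ENNReal.ofReal (∫ v, (Iio B).indicator (markdown D) v * x v ∂D)
      = ∫⁻ v in Iio B, ENNReal.ofReal (x v) * ENNReal.ofReal (markdown D v) ∂D := by
  have i2 := integrable_mul_of_mem_unit hx h0 h1 (integrable_indicator_markdown hD hB)
  have hnn : ∀ v, 0 ≤ (Iio B).indicator (markdown D) v :=
    fun v => indicator_nonneg (fun v _ => markdown_nonneg D v) v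
  rw [ofReal_integral_eq_lintegral_ofReal i2
    (Filter.Eventually.of_forall fun v => mul_nonneg (hnn v) (h0 v)),
    ← lintegral_indicator measurableSet_Iio]
  refine lintegral_congr fun v => ?_
  by_cases hv : v ∈ Iio B
  · simp only [indicator_of_mem hv]
    rw [ENNReal.ofReal_mul (markdown_nonneg D v), mul_comm]
  · simp [hv]

theorem integral_payment_le (hmono : Monotone x) :
    ∫ v, (min v B * x v - rent x (min v B)) ∂D ≤ ∫ v, truncVirtualValue D B v * x v ∂D := by
  have := hD.prob
  rw [integral_payment_sub_eq hD hB0 hB hx h0 h1]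
  have h := lintegral_markdown_le hD hB (x := fun v => ENNReal.ofReal (x v))
    fun a b hab => ENNReal.ofReal_le_ofReal (hmono hab)
  rw [← ofReal_integral_markdown hD hB hx h0 h1, ← ofReal_integral_rent_min hx h0 h1 D hB0,
    ENNReal.ofReal_le_ofReal_iff (integral_nonneg fun v => rent_nonneg h0 _)] at h
  linarith

/-- If the information rent of `x` below `B` is at most its expected markdown, the expected payment
is at least the expected truncated virtual value served. -/
theorem le_integral_payment
    (h : ∫⁻ t in Ioo 0 B, ENNReal.ofReal (x t) * D (Ioi t)
      ≤ ∫⁻ v in Iio B, ENNReal.ofReal (x v) * ENNReal.ofReal (markdown D v) ∂D) :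
    ∫ v, truncVirtualValue D B v * x v ∂D ≤ ∫ v, (min v B * x v - rent x (min v B)) ∂D := by
  have := hD.prob
  rw [integral_payment_sub_eq hD hB0 hB hx h0 h1]
  rw [← ofReal_integral_markdown hD hB hx h0 h1, ← ofReal_integral_rent_min hx h0 h1 D hB0,
    ENNReal.ofReal_le_ofReal_iff] at h
  · linarith
  · exact integral_nonneg fun v =>
      mul_nonneg (indicator_nonneg (fun v _ => markdown_nonneg D v) v) (h0 v)

end Comparison

/-- The envelope inequality: a function with the monotone subgradient `x` grows at least by the
integral of `x`. -/
theorem rent_le_of_subgradient {u x : ℝ → ℝ} (hx : Monotone x)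
    (hu : ∀ v w, 0 ≤ v → 0 ≤ w → (w - v) * x v ≤ u w - u v) {v : ℝ} (hv : 0 ≤ v) :
    rent x v ≤ u v - u 0 := by
  have hint : ∀ a b : ℝ, IntervalIntegrable x volume a b := fun a b => hx.intervalIntegrable
  have hrent : rent x v = ∫ t in (0 : ℝ)..v, x t := by
    rw [intervalIntegral.integral_of_le hv, integral_Ioc_eq_integral_Ioo]; rfl
  have key : ∀ N : ℕ, rent x v - (u v - u 0) ≤ (v * (x v - x 0)) / ((N : ℝ) + 1) := by
    intro N
    have hN : (0 : ℝ) < (N : ℝ) + 1 := by positivity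
    set s : ℕ → ℝ := fun k => v * k / (N + 1) with hs
    have hs0 : s 0 = 0 := by simp [hs]
    have hsN : s (N + 1) = v := by
      simp only [hs]; push_cast; field_simp
    have hstep : ∀ k, s (k + 1) - s k = v / (N + 1) := by
      intro k; simp only [hs]; push_cast; field_simp; ring
    have hsmono : ∀ k, s k ≤ s (k + 1) := by
      intro k
      have : 0 ≤ v / ((N : ℝ) + 1) := by positivity
      linarith [hstep k]
    have hsnn : ∀ k, 0 ≤ s k := fun k => by simp only [hs]; positivity
    have e1 : u v - u 0 = ∑ k ∈ Finset.range (N + 1), (u (s (k + 1)) - u (s k)) := by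
      rw [Finset.sum_range_sub (fun k => u (s k)), hs0, hsN]
    have e2 : x v - x 0 = ∑ k ∈ Finset.range (N + 1), (x (s (k + 1)) - x (s k)) := by
      rw [Finset.sum_range_sub (fun k => x (s k)), hs0, hsN]
    have e3 : rent x v = ∑ k ∈ Finset.range (N + 1), ∫ t in s k..s (k + 1), x t := by
      rw [intervalIntegral.sum_integral_adjacent_intervals fun k _ => hint _ _, hs0, hsN, hrent]
    rw [mul_comm, mul_div_assoc, e1, e2, e3, Finset.sum_mul, ← Finset.sum_sub_distrib]
    refine Finset.sum_le_sum fun k _ => ?_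
    have b1 : ∫ t in s k..s (k + 1), x t ≤ (s (k + 1) - s k) * x (s (k + 1)) := by
      have := intervalIntegral.integral_mono_on (hsmono k) (hint _ _)
        (intervalIntegrable_const (c := x (s (k + 1)))) fun t ht => hx ht.2
      simpa using this
    have b2 := hu (s k) (s (k + 1)) (hsnn _) (hsnn _)
    rw [hstep k] at b1 b2
    linarith
  have hlim := tendsto_const_div_atTop_nhds_zero_nat (v * (x v - x 0))
  have hlim' := (Filter.tendsto_add_atTop_iff_nat 1).mpr hlim
  have : rent x v - (u v - u 0) ≤ 0 :=
    ge_of_tendsto' hlim' fun N => by simpa using key N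
  linarith

/-! ### Upper bound on the revenue of Bayesian incentive compatible mechanisms -/

/-- Integration over a product measure, resampling one coordinate. -/
theorem integral_pi_eq_update {n : ℕ} (D : Fin n → Measure ℝ) [∀ i, IsProbabilityMeasure (D i)]
    (i : Fin n) {f : (Fin n → ℝ) → ℝ} (hf : Integrable f (Measure.pi D)) :
    ∫ w, f w ∂(Measure.pi D) = ∫ v, (∫ w, f (Function.update w i v) ∂(Measure.pi D)) ∂(D i) := by
  have hm := measurable_update_uncurry i
  have hf' := hf
  rw [pi_eq_map_update D i] at hf'
  conv_lhs => rw [pi_eq_map_update D i]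
  rw [integral_map hm.aemeasurable hf'.aestronglyMeasurable]
  exact integral_prod_symm _ (hf'.comp_measurable hm)

theorem integral_pi_eq_update_inner {n : ℕ} (D : Fin n → Measure ℝ)
    [∀ i, IsProbabilityMeasure (D i)] (i : Fin n) {f : (Fin n → ℝ) → ℝ}
    (hf : Integrable f (Measure.pi D)) :
    ∫ w, f w ∂(Measure.pi D) = ∫ w, (∫ v, f (Function.update w i v) ∂(D i)) ∂(Measure.pi D)
      ∧ Integrable (fun w => ∫ v, f (Function.update w i v) ∂(D i)) (Measure.pi D) := by
  have hm := measurable_update_uncurry i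
  have hf' := hf
  rw [pi_eq_map_update D i] at hf'
  refine ⟨?_, (hf'.comp_measurable hm).integral_prod_left⟩
  conv_lhs => rw [pi_eq_map_update D i]
  rw [integral_map hm.aemeasurable hf'.aestronglyMeasurable]
  exact integral_prod _ (hf'.comp_measurable hm)

theorem integrable_integral_update {n : ℕ} (D : Fin n → Measure ℝ)
    [∀ i, IsProbabilityMeasure (D i)] (i : Fin n) {f : (Fin n → ℝ) → ℝ}
    (hf : Integrable f (Measure.pi D)) :
    Integrable (fun v => ∫ w, f (Function.update w i v) ∂(Measure.pi D)) (D i) := by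
  have hm := measurable_update_uncurry i
  rw [pi_eq_map_update D i] at hf
  exact (hf.comp_measurable hm).integral_prod_right

theorem measurable_integral_update {n : ℕ} (D : Fin n → Measure ℝ)
    [∀ i, IsProbabilityMeasure (D i)] (i : Fin n) {f : (Fin n → ℝ) → ℝ} (hf : Measurable f) :
    Measurable fun v => ∫ w, f (Function.update w i v) ∂(Measure.pi D) := by
  have h : StronglyMeasurable fun z : (Fin n → ℝ) × ℝ => f (Function.update z.1 i z.2) :=
    (hf.comp (measurable_update_uncurry i)).stronglyMeasurable
  exact h.integral_prod_left.measurable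

theorem ae_pi_of_ae {n : ℕ} (D : Fin n → Measure ℝ) [∀ i, IsProbabilityMeasure (D i)]
    {p : Fin n → ℝ → Prop} (h : ∀ i, ∀ᵐ v ∂(D i), p i v) :
    ∀ᵐ w ∂(Measure.pi D), ∀ i, p i (w i) :=
  ae_all_iff.mpr fun i => (Measure.tendsto_eval_ae_ae (μ := D) (i := i)).eventually (h i)

theorem Mechanism.alloc_le_one {n : ℕ} (M : Mechanism n) {b : Fin n → ℝ} (hb : ∀ j, 0 ≤ b j)
    (i : Fin n) : M.alloc b i ≤ 1 :=
  (Finset.single_le_sum (fun j _ => M.alloc_nonneg b hb j) (Finset.mem_univ i)).trans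
    (M.alloc_sum_le_one b hb)

theorem update_nonneg {n : ℕ} {w : Fin n → ℝ} (hw : ∀ j, 0 ≤ w j) {b : ℝ} (hb : 0 ≤ b)
    (i : Fin n) (j : Fin n) : 0 ≤ Function.update w i b j := by
  by_cases h : j = i
  · subst h; simpa
  · simpa [Function.update_of_ne h] using hw j

/-- The interim allocation of bidder `i`: the probability of winning with the bid `b`. Negative
bids are assigned the allocation `0`, which keeps the function monotone on the whole line. -/
def interimAlloc {n : ℕ} (M : Mechanism n) (D : Fin n → Measure ℝ) (i : Fin n) : ℝ → ℝ :=
  (Ici 0).indicator fun b => ∫ w, M.alloc (Function.update w i b) i ∂(Measure.pi D)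

/-- The interim payment of bidder `i`: the expected payment with the bid `b`. -/
def interimPay {n : ℕ} (M : Mechanism n) (D : Fin n → Measure ℝ) (i : Fin n) (b : ℝ) : ℝ :=
  ∫ w, M.pay (Function.update w i b) i ∂(Measure.pi D)

section Upper

variable {n : ℕ} (M : Mechanism n) (D : Fin n → Measure ℝ) (hD : ∀ i, IsValueDistribution (D i))
  (i : Fin n)
include hD

theorem ae_pi_nonneg : ∀ᵐ w ∂(Measure.pi D), ∀ j, 0 ≤ w j := by
  have := fun i => (hD i).prob
  exact ae_pi_of_ae D (p := fun _ v => 0 ≤ v) fun i => ae_nonneg_of_isValueDistribution (hD i)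

theorem integrable_alloc_update {b : ℝ} (hb : 0 ≤ b) :
    Integrable (fun w => M.alloc (Function.update w i b) i) (Measure.pi D) := by
  have := fun i => (hD i).prob
  refine Integrable.mono' (g := fun _ => 1) (integrable_const _)
    ((M.measurable_alloc i).comp ((measurable_update_uncurry i).comp
      (measurable_id.prodMk measurable_const))).aestronglyMeasurable ?_
  filter_upwards [ae_pi_nonneg D hD] with w hw
  have hu := update_nonneg hw hb i
  rw [Real.norm_eq_abs, abs_of_nonneg (M.alloc_nonneg _ hu i)]
  exact M.alloc_le_one hu i

theorem integrable_truncVirtualValue_mul_alloc {B : ℝ} (hB : 0 ≤ B) (hgap : NoGapAcross (D i) B) :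
    Integrable (fun w => truncVirtualValue (D i) B (w i) * M.alloc w i) (Measure.pi D) := by
  have := fun i => (hD i).prob
  have h1 : Integrable (fun w : Fin n → ℝ => truncVirtualValue (D i) B (w i)) (Measure.pi D) :=
    (measurePreserving_eval D i).integrable_comp_of_integrable
      (integrable_truncVirtualValue (hD i) hB hgap)
  refine h1.mul_bdd (c := 1) (M.measurable_alloc i).aestronglyMeasurable ?_
  filter_upwards [ae_pi_nonneg D hD] with w hw
  rw [Real.norm_eq_abs, abs_of_nonneg (M.alloc_nonneg _ hw i)]
  exact M.alloc_le_one hw i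

theorem interimAlloc_nonneg (b : ℝ) : 0 ≤ interimAlloc M D i b := by
  refine indicator_nonneg (fun b hb => ?_) b
  refine integral_nonneg_of_ae ?_
  filter_upwards [ae_pi_nonneg D hD] with w hw
  exact M.alloc_nonneg _ (update_nonneg hw hb i) i

theorem interimAlloc_le_one (b : ℝ) : interimAlloc M D i b ≤ 1 := by
  have := fun i => (hD i).prob
  refine indicator_le' (g := fun _ => (1 : ℝ)) (fun b hb => ?_) (fun _ _ => zero_le_one) b
  calc ∫ w, M.alloc (Function.update w i b) i ∂(Measure.pi D) ≤ ∫ w, 1 ∂(Measure.pi D) := by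
        refine integral_mono_ae (integrable_alloc_update M D hD i hb) (integrable_const _) ?_
        filter_upwards [ae_pi_nonneg D hD] with w hw
        exact M.alloc_le_one (update_nonneg hw hb i) i
    _ = 1 := by simp

variable (hM : IsBIC M D)
include hM

theorem interimUtility_eq {v b : ℝ} (hb : 0 ≤ b) :
    interimUtility M D i v b = v * interimAlloc M D i b - interimPay M D i b := by
  unfold interimUtility interimPay interimAlloc
  rw [integral_sub ((integrable_alloc_update M D hD i hb).const_mul v)
    (hM.integrable_interim_pay i b hb), integral_const_mul, indicator_of_mem (by exact hb)]

theorem interim_incentive {v b : ℝ} (hv : 0 ≤ v) (hb : 0 ≤ b) :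
    v * interimAlloc M D i b - interimPay M D i b
      ≤ v * interimAlloc M D i v - interimPay M D i v := by
  rw [← interimUtility_eq M D hD i hM hb, ← interimUtility_eq M D hD i hM hv]
  exact hM.incentive_compatible i v b hv hb

theorem interimAlloc_mono : Monotone (interimAlloc M D i) := by
  intro a b hab
  by_cases ha : 0 ≤ a
  · have hb := ha.trans hab
    rcases hab.eq_or_lt with rfl | hlt
    · rfl
    have h1 := interim_incentive M D hD i hM ha hb
    have h2 := interim_incentive M D hD i hM hb ha
    by_contra hcon
    nlinarith [mul_pos (sub_pos.mpr hlt) (sub_pos.mpr (not_le.mp hcon))]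
  · rw [interimAlloc, indicator_of_notMem (by exact ha)]
    exact interimAlloc_nonneg M D hD i b

theorem interimPay_mono {a b : ℝ} (ha : 0 ≤ a) (hab : a ≤ b) :
    interimPay M D i a ≤ interimPay M D i b := by
  have h1 := interim_incentive M D hD i hM ha (ha.trans hab)
  have h2 := mul_le_mul_of_nonneg_left (interimAlloc_mono M D hD i hM hab) ha
  linarith

theorem interimPay_le {v : ℝ} (hv : 0 ≤ v) :
    interimPay M D i v ≤ v * interimAlloc M D i v - rent (interimAlloc M D i) v := by
  have h := rent_le_of_subgradient (u := fun v => v * interimAlloc M D i v - interimPay M D i v)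
    (interimAlloc_mono M D hD i hM) (fun v w hv hw => by
      have := interim_incentive M D hD i hM hw hv
      linarith) hv
  have h0 := hM.individually_rational i 0 le_rfl
  rw [interimUtility_eq M D hD i hM le_rfl] at h0
  linarith

/-- The expected payment of a bidder is at most the expected truncated virtual value served to
her, up to the payments collected from values above the truncation. -/
theorem integral_pay_le {B : ℝ} (hB0 : 0 ≤ B) (hB : NoGapAcross (D i) B) :
    ∫ w, M.pay w i ∂(Measure.pi D)
      ≤ ∫ w, truncVirtualValue (D i) B (w i) * M.alloc w i ∂(Measure.pi D)
        + ∫ v in Ioi B, (interimPay M D i v - interimPay M D i 0) ∂(D i) := by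
  have := fun i => (hD i).prob
  have hX0 := interimAlloc_nonneg M D hD i
  have hX1 := interimAlloc_le_one M D hD i
  have hXm := interimAlloc_mono M D hD i hM
  have hae := ae_nonneg_of_isValueDistribution (hD i)
  have hφX := integrable_truncVirtualValue_mul_alloc M D hD i hB0 hB
  have e1 : ∫ w, M.pay w i ∂(Measure.pi D) = ∫ v, interimPay M D i v ∂(D i) :=
    integral_pi_eq_update D i (hM.integrable_pay i)
  have e2 : ∫ w, truncVirtualValue (D i) B (w i) * M.alloc w i ∂(Measure.pi D)
      = ∫ v, truncVirtualValue (D i) B v * interimAlloc M D i v ∂(D i) := by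
    rw [integral_pi_eq_update D i hφX]
    refine integral_congr_ae ?_
    filter_upwards [hae] with v hv
    simp only [Function.update_self]
    rw [integral_const_mul, interimAlloc, indicator_of_mem (by exact hv)]
  have hP : Integrable (interimPay M D i) (D i) :=
    integrable_integral_update D i (hM.integrable_pay i)
  have hPm : Measurable (interimPay M D i) := measurable_integral_update D i (M.measurable_pay i)
  have hPt : Integrable (fun v => interimPay M D i (min v B)) (D i) := by
    refine Integrable.mono' (g := fun _ => |interimPay M D i 0| + |interimPay M D i B|)
      (integrable_const _)
      (hPm.comp (measurable_id.min measurable_const)).aestronglyMeasurable ?_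
    filter_upwards [hae] with v hv
    have h1 := interimPay_mono M D hD i hM le_rfl (le_min hv hB0)
    have h2 := interimPay_mono M D hD i hM (le_min hv hB0) (min_le_right v B)
    rw [Real.norm_eq_abs, abs_le]
    constructor
    · linarith [neg_abs_le (interimPay M D i 0), abs_nonneg (interimPay M D i B)]
    · linarith [le_abs_self (interimPay M D i B), abs_nonneg (interimPay M D i 0)]
  have hPd : Integrable (fun v => interimPay M D i v - interimPay M D i 0) (D i) :=
    hP.sub (integrable_const _)
  -- a payment above `B` exceeds the one at `B` by at most its excess over the payment at `0`
  have e3 : ∫ v, interimPay M D i v ∂(D i) ≤ ∫ v, interimPay M D i (min v B) ∂(D i)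
      + ∫ v in Ioi B, (interimPay M D i v - interimPay M D i 0) ∂(D i) := by
    rw [← integral_indicator measurableSet_Ioi, ← integral_add hPt
      (hPd.indicator measurableSet_Ioi)]
    refine integral_mono hP (hPt.add (hPd.indicator measurableSet_Ioi)) fun v => ?_
    by_cases hv : v ∈ Ioi B
    · simp only [indicator_of_mem hv]
      rw [min_eq_right (le_of_lt hv)]
      linarith [interimPay_mono M D hD i hM le_rfl hB0]
    · simp only [indicator_of_notMem hv, add_zero]
      rw [min_eq_left (not_lt.mp hv)]
  have e4 : ∫ v, interimPay M D i (min v B) ∂(D i)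
      ≤ ∫ v, (min v B * interimAlloc M D i v - rent (interimAlloc M D i) (min v B)) ∂(D i) := by
    refine integral_mono_ae hPt
      ((integrable_mul_of_mem_unit hXm.measurable hX0 hX1 (integrable_min (hD i) hB0)).sub
        (integrable_rent_min hXm.measurable hX0 hX1 (D i) hB0)) ?_
    filter_upwards [hae] with v hv
    have h1 := interimPay_le M D hD i hM (le_min hv hB0)
    have h2 := mul_le_mul_of_nonneg_left (hXm (min_le_left v B)) (le_min hv hB0)
    linarith
  have e5 := integral_payment_le (hD i) hB0 hB hXm.measurable hX0 hX1 hXm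
  rw [e1, e2]
  linarith

end Upper

/-! ### Mechanisms given by scores -/

/-- Bidder `i` wins if her score is positive and highest, ties being broken in favour of the lowest
index. -/
def Wins {n : ℕ} (s : Fin n → ℝ → ℝ) (b : Fin n → ℝ) (i : Fin n) : Prop :=
  0 < s i (b i) ∧ ∀ j, j ≠ i → s j (b j) ≤ s i (b i) ∧ (j < i → s j (b j) < s i (b i))

open Classical in
/-- The allocation rule that gives the item to the winner. -/
def scoreAlloc {n : ℕ} (s : Fin n → ℝ → ℝ) (b : Fin n → ℝ) (i : Fin n) : ℝ :=
  if Wins s b i then 1 else 0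

/-- The Myerson payment for `scoreAlloc`, with bids truncated at `B`. -/
def scorePay {n : ℕ} (s : Fin n → ℝ → ℝ) (B : ℝ) (b : Fin n → ℝ) (i : Fin n) : ℝ :=
  min (b i) B * scoreAlloc s b i
    - rent (fun t => scoreAlloc s (Function.update b i t) i) (min (b i) B)

section Score

variable {n : ℕ} {s : Fin n → ℝ → ℝ}

theorem scoreAlloc_nonneg (b : Fin n → ℝ) (i : Fin n) : 0 ≤ scoreAlloc s b i := by
  unfold scoreAlloc; split_ifs <;> norm_num

theorem scoreAlloc_le_one (b : Fin n → ℝ) (i : Fin n) : scoreAlloc s b i ≤ 1 := by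
  unfold scoreAlloc; split_ifs <;> norm_num

theorem Wins.unique {b : Fin n → ℝ} {i j : Fin n} (hi : Wins s b i) (hj : Wins s b j) : i = j := by
  by_contra hne
  rcases lt_or_gt_of_ne hne with h | h
  · exact absurd ((hj.2 i hne).2 h) (not_lt.mpr (hi.2 j (Ne.symm hne)).1)
  · exact absurd ((hi.2 j (Ne.symm hne)).2 h) (not_lt.mpr (hj.2 i hne).1)

theorem Wins.scoreAlloc_eq {b : Fin n → ℝ} {i : Fin n} (hi : Wins s b i) (j : Fin n) :
    scoreAlloc s b j = if j = i then 1 else 0 := by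
  unfold scoreAlloc
  by_cases h : j = i
  · subst h; simp [hi]
  · have : ¬ Wins s b j := fun hj => h (hj.unique hi)
    simp [h, this]

theorem exists_wins {b : Fin n → ℝ} {k : Fin n} (hk : 0 < s k (b k)) : ∃ i, Wins s b i := by
  classical
  obtain ⟨m, -, hm⟩ := Finset.exists_max_image Finset.univ (fun i => s i (b i))
    ⟨k, Finset.mem_univ k⟩
  set T := Finset.univ.filter fun i => s i (b i) = s m (b m) with hT
  have hTne : T.Nonempty := ⟨m, by simp [hT]⟩
  have hmin : s (T.min' hTne) (b (T.min' hTne)) = s m (b m) :=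
    (Finset.mem_filter.mp (T.min'_mem hTne)).2
  refine ⟨T.min' hTne, ?_, fun j hj => ⟨?_, fun hlt => ?_⟩⟩
  · rw [hmin]; exact hk.trans_le (hm k (Finset.mem_univ k))
  · rw [hmin]; exact hm j (Finset.mem_univ j)
  · rw [hmin]
    refine lt_of_le_of_ne (hm j (Finset.mem_univ j)) fun heq => ?_
    exact absurd (T.min'_le j (by simp [hT, heq])) (not_le.mpr hlt)

theorem sum_scoreAlloc_le_one (b : Fin n → ℝ) : ∑ i, scoreAlloc s b i ≤ 1 := by
  by_cases h : ∃ i, Wins s b i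
  · obtain ⟨i, hi⟩ := h
    simp [hi.scoreAlloc_eq]
  · push Not at h
    simp [scoreAlloc, h]

theorem wins_update_iff (b : Fin n → ℝ) (i : Fin n) (t : ℝ) :
    Wins s (Function.update b i t) i ↔
      0 < s i t ∧ ∀ j, j ≠ i → s j (b j) ≤ s i t ∧ (j < i → s j (b j) < s i t) := by
  unfold Wins
  rw [Function.update_self]
  refine and_congr_right fun _ => forall_congr' fun j => forall_congr' fun hj => ?_
  rw [Function.update_of_ne hj]

theorem scoreAlloc_update_congr (b : Fin n → ℝ) (i : Fin n) {t t' : ℝ} (h : s i t = s i t') :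
    scoreAlloc s (Function.update b i t) i = scoreAlloc s (Function.update b i t') i := by
  unfold scoreAlloc
  simp only [wins_update_iff, h]

theorem scoreAlloc_update_eq_zero (b : Fin n → ℝ) (i : Fin n) {t : ℝ} (h : s i t ≤ 0) :
    scoreAlloc s (Function.update b i t) i = 0 := by
  unfold scoreAlloc
  rw [if_neg]
  rw [wins_update_iff]
  exact fun h' => absurd h'.1 (not_lt.mpr h)

theorem scoreAlloc_update_mono (hs : ∀ i, Monotone (s i)) (b : Fin n → ℝ) (i : Fin n) :
    Monotone fun t => scoreAlloc s (Function.update b i t) i := by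
  intro t t' htt
  have h := hs i htt
  by_cases hw : Wins s (Function.update b i t) i
  · have hw' : Wins s (Function.update b i t') i := by
      rw [wins_update_iff] at hw ⊢
      exact ⟨hw.1.trans_le h, fun j hj => ⟨(hw.2 j hj).1.trans h,
        fun hlt => ((hw.2 j hj).2 hlt).trans_le h⟩⟩
    simp [scoreAlloc, hw, hw']
  · have : scoreAlloc s (Function.update b i t) i = 0 := by simp [scoreAlloc, hw]
    simp only [this]
    exact scoreAlloc_nonneg _ _

theorem measurable_scoreAlloc (hs : ∀ i, Monotone (s i)) (i : Fin n) :
    Measurable fun b => scoreAlloc s b i := by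
  classical
  have hm : ∀ j, Measurable fun b : Fin n → ℝ => s j (b j) := fun j =>
    (hs j).measurable.comp (measurable_pi_apply j)
  have hset : MeasurableSet {b | Wins s b i} := by
    have : {b | Wins s b i} = {b | 0 < s i (b i)} ∩ ⋂ j : {j // j ≠ i},
        ({b | s j (b j) ≤ s i (b i)} ∩ {b | (j : Fin n) < i → s j (b j) < s i (b i)}) := by
      ext b
      simp [Wins]
    rw [this]
    refine (measurableSet_lt measurable_const (hm i)).inter (MeasurableSet.iInter fun j => ?_)
    refine (measurableSet_le (hm j) (hm i)).inter ?_
    by_cases hj : (j : Fin n) < i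
    · simpa [hj] using measurableSet_lt (hm j) (hm i)
    · simp [hj]
  unfold scoreAlloc
  exact Measurable.ite hset measurable_const measurable_const

theorem measurable_scorePay (hs : ∀ i, Monotone (s i)) (B : ℝ) (i : Fin n) :
    Measurable fun b => scorePay s B b i := by
  have hmin : Measurable fun b : Fin n → ℝ => min (b i) B :=
    (measurable_pi_apply i).min measurable_const
  refine (hmin.mul (measurable_scoreAlloc hs i)).sub ?_
  have hind : StronglyMeasurable ({z : (Fin n → ℝ) × ℝ | 0 < z.2 ∧ z.2 < min (z.1 i) B}.indicator
      fun z => scoreAlloc s (Function.update z.1 i z.2) i) := by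
    refine (((measurable_scoreAlloc hs i).comp (measurable_update_uncurry i)).indicator
      ?_).stronglyMeasurable
    exact (measurableSet_lt measurable_const measurable_snd).inter
      (measurableSet_lt measurable_snd (hmin.comp measurable_fst))
  have h := (hind.integral_prod_right' (ν := volume)).measurable
  convert h using 2 with b
  rw [rent, ← integral_indicator measurableSet_Ioo]
  rfl

/-- The winner-take-all mechanism with scores `s` and Myerson payments truncated at `B`. -/
def scoreMechanism (s : Fin n → ℝ → ℝ) (hs : ∀ i, Monotone (s i)) (B : ℝ) : Mechanism n where
  alloc := scoreAlloc s
  pay := scorePay s B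
  measurable_alloc := measurable_scoreAlloc hs
  measurable_pay := measurable_scorePay hs B
  alloc_nonneg b _ i := scoreAlloc_nonneg b i
  alloc_sum_le_one b _ := sum_scoreAlloc_le_one b

theorem scorePay_update (B : ℝ) (w : Fin n → ℝ) (i : Fin n) (b : ℝ) :
    scorePay s B (Function.update w i b) i
      = min b B * scoreAlloc s (Function.update w i b) i
        - rent (fun t => scoreAlloc s (Function.update w i t) i) (min b B) := by
  simp [scorePay]

theorem mul_sub_le_rent_sub {x : ℝ → ℝ} (hx : Monotone x) {a b : ℝ} (ha : 0 ≤ a) (hb : 0 ≤ b) :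
    (b - a) * x a ≤ rent x b - rent x a := by
  have hint : ∀ a b : ℝ, IntervalIntegrable x volume a b := fun a b => hx.intervalIntegrable
  have hrent : ∀ v, 0 ≤ v → rent x v = ∫ t in (0 : ℝ)..v, x t := fun v hv => by
    rw [intervalIntegral.integral_of_le hv, integral_Ioc_eq_integral_Ioo]; rfl
  rw [hrent a ha, hrent b hb, intervalIntegral.integral_interval_sub_left (hint _ _) (hint _ _)]
  rcases le_total a b with h | h
  · have := intervalIntegral.integral_mono_on h (intervalIntegrable_const (c := x a)) (hint a b)
      fun t ht => hx ht.1
    simpa using this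
  · have := intervalIntegral.integral_mono_on h (hint b a) (intervalIntegrable_const (c := x a))
      fun t ht => hx ht.2
    rw [intervalIntegral.integral_symm]
    simp only [intervalIntegral.integral_const, smul_eq_mul] at this
    linarith

theorem abs_scorePay_le (hs : ∀ i, Monotone (s i)) {B : ℝ} (hB : 0 ≤ B) {b : Fin n → ℝ} {i : Fin n}
    (hb : 0 ≤ b i) : |scorePay s B b i| ≤ B := by
  have hm := le_min hb hB
  have h1 := rent_nonneg (x := fun t => scoreAlloc s (Function.update b i t) i)
    (fun t => scoreAlloc_nonneg _ _) (min (b i) B)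
  have h2 := rent_le (scoreAlloc_update_mono hs b i).measurable
    (fun t => scoreAlloc_nonneg _ _) (fun t => scoreAlloc_le_one _ _) hm
  have h3 := mul_nonneg hm (scoreAlloc_nonneg (s := s) b i)
  have h4 := mul_le_mul_of_nonneg_left (scoreAlloc_le_one (s := s) b i) hm
  have h5 := min_le_right (b i) B
  unfold scorePay
  rw [abs_le]
  constructor <;> linarith

/-- Truthful bidding is a dominant strategy in a score mechanism. -/
theorem scorePay_incentive (hs : ∀ i, Monotone (s i)) {B : ℝ} (hB : 0 ≤ B)
    (hconst : ∀ i, ∀ t, B ≤ t → s i t = s i B) (w : Fin n → ℝ) (i : Fin n) {v b : ℝ}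
    (hv : 0 ≤ v) (hb : 0 ≤ b) :
    v * scoreAlloc s (Function.update w i b) i - scorePay s B (Function.update w i b) i
      ≤ v * scoreAlloc s (Function.update w i v) i
        - scorePay s B (Function.update w i v) i := by
  rw [scorePay_update, scorePay_update]
  have hmin : ∀ t, scoreAlloc s (Function.update w i t) i
      = scoreAlloc s (Function.update w i (min t B)) i := by
    intro t
    rcases le_total t B with h | h
    · rw [min_eq_left h]
    · rw [min_eq_right h]
      exact scoreAlloc_update_congr w i (hconst i t h)
  have hmono := scoreAlloc_update_mono hs w i
  have h1 := mul_sub_le_rent_sub hmono (le_min hb hB) (le_min hv hB)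
  rw [hmin b, hmin v]
  have h2 : (v - min v B) * scoreAlloc s (Function.update w i (min b B)) i
      ≤ (v - min v B) * scoreAlloc s (Function.update w i (min v B)) i := by
    rcases le_total v B with h | h
    · simp [min_eq_left h]
    · rw [min_eq_right h]
      exact mul_le_mul_of_nonneg_left (hmono (min_le_right b B)) (sub_nonneg.mpr h)
  linarith

theorem scorePay_utility_nonneg (hs : ∀ i, Monotone (s i)) {B : ℝ} (hB : 0 ≤ B)
    (hconst : ∀ i, ∀ t, B ≤ t → s i t = s i B) (w : Fin n → ℝ) (i : Fin n) {v : ℝ} (hv : 0 ≤ v) :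
    0 ≤ v * scoreAlloc s (Function.update w i v) i
        - scorePay s B (Function.update w i v) i := by
  have h := scorePay_incentive hs hB hconst w i hv (le_refl (0 : ℝ))
  rw [scorePay_update, min_eq_left hB] at h
  have h0 : rent (fun t => scoreAlloc s (Function.update w i t) i) 0 = 0 := by simp [rent]
  rw [h0] at h
  have := mul_nonneg hv (scoreAlloc_nonneg (s := s) (Function.update w i 0) i)
  linarith

variable {D : Fin n → Measure ℝ} (hD : ∀ i, IsValueDistribution (D i)) (hs : ∀ i, Monotone (s i))
  {B : ℝ} (hB : 0 ≤ B)
include hD hs hB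

theorem integrable_scorePay (i : Fin n) :
    Integrable (fun w => scorePay s B w i) (Measure.pi D) := by
  have := fun i => (hD i).prob
  refine Integrable.mono' (g := fun _ => B) (integrable_const _)
    (measurable_scorePay hs B i).aestronglyMeasurable ?_
  filter_upwards [ae_pi_nonneg D hD] with w hw
  exact abs_scorePay_le hs hB (hw i)

theorem integrable_scorePay_update (i : Fin n) {b : ℝ} (hb : 0 ≤ b) :
    Integrable (fun w => scorePay s B (Function.update w i b) i) (Measure.pi D) := by
  have := fun i => (hD i).prob
  refine Integrable.mono' (g := fun _ => B) (integrable_const _)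
    ((measurable_scorePay hs B i).comp ((measurable_update_uncurry i).comp
      (measurable_id.prodMk measurable_const))).aestronglyMeasurable ?_
  refine Filter.Eventually.of_forall fun w => ?_
  exact abs_scorePay_le hs hB (by simpa using hb)

theorem isBIC_scoreMechanism (hconst : ∀ i, ∀ t, B ≤ t → s i t = s i B) :
    IsBIC (scoreMechanism s hs B) D := by
  have hint : ∀ i, ∀ v b : ℝ, 0 ≤ b → Integrable (fun w =>
      v * (scoreMechanism s hs B).alloc (Function.update w i b) i
        - (scoreMechanism s hs B).pay (Function.update w i b) i) (Measure.pi D) := fun i v b hb =>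
    ((integrable_alloc_update _ D hD i hb).const_mul v).sub
      (integrable_scorePay_update hD hs hB i hb)
  refine ⟨integrable_scorePay hD hs hB, fun i b hb => integrable_scorePay_update hD hs hB i hb,
    fun i v b hv hb => ?_, fun i v hv => ?_⟩
  · exact integral_mono (hint i v b hb) (hint i v v hv)
      fun w => scorePay_incentive hs hB hconst w i hv hb
  · exact integral_nonneg fun w => scorePay_utility_nonneg hs hB hconst w i hv

end Score

/-- The score `s` extracts the whole virtual value from `D`: every allocation rule that depends on
the value only through the score and vanishes at scores `≤ 0` has an information rent below `B` of
at most its expected markdown. -/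
def ExtractsVirtualValue (D : Measure ℝ) (B : ℝ) (s : ℝ → ℝ) : Prop :=
  ∀ x : ℝ → ENNReal, Measurable x → (∀ t t', s t = s t' → x t = x t') → (∀ t, s t ≤ 0 → x t = 0) →
    ∫⁻ t in Ioo 0 B, x t * D (Ioi t) ≤ ∫⁻ v in Iio B, x v * ENNReal.ofReal (markdown D v) ∂D

/-- A score mechanism whose scores extract the virtual values earns at least the expected truncated
virtual value of the winner. -/
theorem le_integral_scorePay {n : ℕ} {s : Fin n → ℝ → ℝ} {D : Fin n → Measure ℝ}
    (hD : ∀ i, IsValueDistribution (D i)) (hs : ∀ i, Monotone (s i)) {B : ℝ} (hB : 0 ≤ B)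
    (i : Fin n) (hgap : NoGapAcross (D i) B) (hext : ExtractsVirtualValue (D i) B (s i)) :
    ∫ w, truncVirtualValue (D i) B (w i) * scoreAlloc s w i ∂(Measure.pi D)
      ≤ ∫ w, scorePay s B w i ∂(Measure.pi D) := by
  have := fun i => (hD i).prob
  obtain ⟨e1, i1⟩ := integral_pi_eq_update_inner D i
    (integrable_truncVirtualValue_mul_alloc (scoreMechanism s hs B) D hD i hB hgap)
  obtain ⟨e2, i2⟩ := integral_pi_eq_update_inner D i (integrable_scorePay hD hs hB i)
  change ∫ w, truncVirtualValue (D i) B (w i) * scoreAlloc s w i ∂(Measure.pi D) = _ at e1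
  rw [e1, e2]
  refine integral_mono i1 i2 fun w => ?_
  have hmono := scoreAlloc_update_mono hs w i
  have h := le_integral_payment (hD i) hB hgap hmono.measurable (fun t => scoreAlloc_nonneg _ _)
    (fun t => scoreAlloc_le_one _ _) (hext (fun t => ENNReal.ofReal
      (scoreAlloc s (Function.update w i t) i)) hmono.measurable.ennreal_ofReal
      (fun t t' htt => by simp only [scoreAlloc_update_congr w i htt])
      (fun t ht => by simp [scoreAlloc_update_eq_zero w i ht]))
  have key : ∫ v, truncVirtualValue (D i) B v * scoreAlloc s (Function.update w i v) i ∂(D i)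
      ≤ ∫ v, scorePay s B (Function.update w i v) i ∂(D i) := by
    refine h.trans (le_of_eq (integral_congr_ae ?_))
    filter_upwards [ae_nonneg_of_isValueDistribution (hD i)] with v hv
    rw [scorePay_update]
  simpa [scoreMechanism] using key

/-! ### Scores for the hard instances -/

/-- Almost no value has a null interval to its left. -/
theorem measure_setOf_exists_Ioc_eq_zero (D : Measure ℝ) :
    D {v | ∃ w < v, D (Ioc w v) = 0} = 0 := by
  have hsub : {v | ∃ w < v, D (Ioc w v) = 0}
      ⊆ ⋃ q : ℚ, {v | (q : ℝ) < v ∧ D (Ioc (q : ℝ) v) = 0} := by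
    rintro v ⟨w, hwv, hw⟩
    obtain ⟨q, hq1, hq2⟩ := exists_rat_btwn hwv
    exact mem_iUnion.mpr ⟨q, hq2, measure_mono_null (Ioc_subset_Ioc_left hq1.le) hw⟩
  refine measure_mono_null hsub (measure_iUnion_null fun q => ?_)
  set S := {v : ℝ | (q : ℝ) < v ∧ D (Ioc (q : ℝ) v) = 0} with hS
  by_cases hmax : ∃ m ∈ S, ∀ v ∈ S, v ≤ m
  · obtain ⟨m, hm, hmax⟩ := hmax
    exact measure_mono_null (t := Ioc (q : ℝ) m) (fun v hv => ⟨hv.1, hmax v hv⟩) hm.2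
  · push Not at hmax
    have : S ⊆ ⋃ r : {r : ℚ // D (Ioc (q : ℝ) r) = 0}, Ioc (q : ℝ) (r : ℚ) := by
      intro v hv
      obtain ⟨v', hv', hlt⟩ := hmax v hv
      obtain ⟨r, hr1, hr2⟩ := exists_rat_btwn hlt
      exact mem_iUnion.mpr ⟨⟨r, measure_mono_null (Ioc_subset_Ioc_right hr2.le) hv'.2⟩,
        hv.1, hr1.le⟩
    exact measure_mono_null this (measure_iUnion_null fun r => r.2)

/-- The score of a bidder with the base distribution: she competes only with values of at least
`v₀`. -/
def baseScore (v₀ t : ℝ) : ℝ := if v₀ ≤ t then 1 / 2 else 0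

/-- The score of a bidder with the low distribution: she competes only with values of at least
`B`. -/
def lowScore (B t : ℝ) : ℝ := if B ≤ t then 3 else 0

/-- The score of a bidder with the high distribution `D`: from `v₂` on, values are ranked by the
distribution function of `D`. The ranking by the distribution function identifies each atom with
the gap above it, and a bid in a gap that begins below `v₂` does not compete. -/
def highScore (D : Measure ℝ) (v₂ B t : ℝ) : ℝ :=
  if B ≤ t then 3 else if D.real (Iio v₂) < D.real (Iic t) then 1 + D.real (Iic t) else 0

theorem monotone_baseScore (v₀ : ℝ) : Monotone (baseScore v₀) := by
  intro s t hst
  unfold baseScore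
  split_ifs with h1 h2 <;> first | exact absurd (h1.trans hst) h2 | norm_num

theorem monotone_lowScore (B : ℝ) : Monotone (lowScore B) := by
  intro s t hst
  unfold lowScore
  split_ifs with h1 h2 <;> first | exact absurd (h1.trans hst) h2 | norm_num

theorem monotone_highScore (D : Measure ℝ) [IsProbabilityMeasure D] (v₂ B : ℝ) :
    Monotone (highScore D v₂ B) := by
  intro s t hst
  have hF : D.real (Iic s) ≤ D.real (Iic t) := measureReal_mono (Iic_subset_Iic.mpr hst)
  have h1 : D.real (Iic s) ≤ 1 := measureReal_le_one
  have h0 : 0 ≤ D.real (Iic t) := measureReal_nonneg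
  unfold highScore
  split_ifs <;> linarith

theorem extractsVirtualValue_baseScore {v₀ B : ℝ} :
    ExtractsVirtualValue (Measure.dirac v₀) B (baseScore v₀) := by
  intro x _ _ hx
  have : ∀ t ∈ Ioo (0 : ℝ) B, x t * Measure.dirac v₀ (Ioi t) = 0 := by
    intro t _
    by_cases h : v₀ ≤ t
    · simp [Measure.dirac_apply' _ measurableSet_Ioi, h]
    · rw [hx t (by simp [baseScore, h]), zero_mul]
  rw [setLIntegral_congr_fun measurableSet_Ioo this]
  simp

theorem extractsVirtualValue_lowScore (D : Measure ℝ) (B : ℝ) :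
    ExtractsVirtualValue D B (lowScore B) := by
  intro x _ _ hx
  have : ∀ t ∈ Ioo (0 : ℝ) B, x t * D (Ioi t) = 0 := by
    intro t ht
    rw [hx t (by simp [lowScore, not_le.mpr ht.2]), zero_mul]
  rw [setLIntegral_congr_fun measurableSet_Ioo this]
  simp

theorem measureReal_Iic_eq_of_measure_Ioc_eq_zero {D : Measure ℝ} {a t : ℝ} (hat : a ≤ t)
    (h : D (Ioc a t) = 0) : D.real (Iic t) = D.real (Iic a) := by
  have : D (Iic t) = D (Iic a) := by
    refine le_antisymm ?_ (measure_mono (Iic_subset_Iic.mpr hat))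
    rw [← Iic_union_Ioc_eq_Iic hat]
    refine (measure_union_le _ _).trans ?_
    rw [h, add_zero]
  simp [measureReal_def, this]

theorem extractsVirtualValue_highScore {D : Measure ℝ} (hD : IsValueDistribution D)
    (hreg : IsRegularDistribution D) {v₂ B : ℝ} (hv₂ : D (Iio v₂) ≠ 0) :
    ExtractsVirtualValue D B (highScore D v₂ B) := by
  have := hD.prob
  intro x hxm hxs hx
  have hlow : ∀ t, t < B → D.real (Iic t) ≤ D.real (Iio v₂) → x t = 0 := fun t htB ht =>
    hx t (by simp [highScore, not_le.mpr htB, not_lt.mpr ht])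
  refine le_lintegral_markdown hD hreg hxm (fun a t hat htB ha hDat => ?_) (fun t ht htB => ?_)
  · refine (hxs t a ?_).le
    simp [highScore, not_le.mpr htB, not_le.mpr (hat.trans htB),
      measureReal_Iic_eq_of_measure_Ioc_eq_zero hat.le hDat]
  · refine hlow t htB (measureReal_mono fun s hs => ?_)
    have htv : t < v₂ := by
      by_contra hcon
      exact hv₂ (measure_mono_null (Iio_subset_Iio (not_lt.mp hcon)) ht)
    exact lt_of_le_of_lt hs htv

/-! ### Thresholds for the truncation -/

/-- A threshold that is a limit from the right of values of `D`, or above all of them, is not inside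
a gap. -/
theorem noGapAcross_of {D : Measure ℝ} {B : ℝ}
    (h : D (Ici B) = 0 ∨ ∀ w, B < w → D (Icc B w) ≠ 0) : NoGapAcross D B := by
  intro a haB ha hDa
  by_contra hcon
  have hlt := not_le.mp hcon
  rcases h with h | h
  · apply hDa
    refine measure_mono_null (t := Ioo a (nextValue D a) ∪ Ici B) (fun w hw => ?_)
      (measure_union_null measure_Ioo_nextValue h)
    rcases lt_or_ge w B with hwB | hwB
    · exact Or.inl ⟨hw, hwB.trans hlt⟩
    · exact Or.inr hwB
  · obtain ⟨w, hw1, hw2⟩ := exists_between hlt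
    exact h w hw1 (measure_mono_null (t := Ioo a (nextValue D a))
      (fun t ht => ⟨haB.trans_le ht.1, ht.2.trans_lt hw2⟩)
      measure_Ioo_nextValue)

/-- Beyond every `C` there is a threshold that is not inside a gap of `D`. -/
theorem exists_threshold_ge (D : Measure ℝ) (C : ℝ) :
    ∃ B, C ≤ B ∧ (D (Ici B) = 0 ∨ ∀ w, B < w → D (Icc B w) ≠ 0) := by
  by_cases h : D (Ici C) = 0
  · exact ⟨C, le_rfl, Or.inl h⟩
  set T := {w : ℝ | C ≤ w ∧ D (Icc C w) ≠ 0} with hT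
  have hne : T.Nonempty := by
    by_contra hcon
    apply h
    have : Ici C ⊆ ⋃ k : ℕ, Icc C (C + k) := by
      intro w hw
      obtain ⟨k, hk⟩ := exists_nat_ge (w - C)
      exact mem_iUnion.mpr ⟨k, hw, by linarith⟩
    refine measure_mono_null this (measure_iUnion_null fun k => ?_)
    by_contra hk
    exact hcon ⟨C + k, by simp, hk⟩
  have hbdd : BddBelow T := ⟨C, fun w hw => hw.1⟩
  refine ⟨sInf T, le_csInf hne fun w hw => hw.1, Or.inr fun w hw h0 => ?_⟩
  obtain ⟨w', hw', hlt⟩ := exists_lt_of_csInf_lt hne hw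
  apply hw'.2
  have hsub : Icc C w' ⊆ (⋃ q : {q : ℚ // (q : ℝ) < sInf T}, Icc C (q : ℝ)) ∪ Icc (sInf T) w := by
    intro t ht
    rcases lt_or_ge t (sInf T) with h1 | h1
    · obtain ⟨q, hq1, hq2⟩ := exists_rat_btwn h1
      exact Or.inl (mem_iUnion.mpr ⟨⟨q, hq2⟩, ht.1, hq1.le⟩)
    · exact Or.inr ⟨h1, ht.2.trans hlt.le⟩
  refine measure_mono_null hsub (measure_union_null (measure_iUnion_null fun q => ?_) h0)
  by_cases hq : C ≤ (q : ℝ)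
  · by_contra hcon
    exact absurd (csInf_le hbdd (show ((q : ℚ) : ℝ) ∈ T from ⟨hq, hcon⟩)) (not_le.mpr q.2)
  · simp [Icc_eq_empty hq]

theorem measurableSet_criticalInterval (v₁ : EReal) (v₂ : ℝ) :
    MeasurableSet (criticalInterval v₁ v₂) :=
  measurableSet_Ici.inter (measurableSet_lt measurable_coe_real_ereal measurable_const)

section Hard

variable {n : ℕ} {Db Dh Dl : Measure ℝ} {v₀ : ℝ} {v₁ : EReal} {v₂ p Δ : ℝ}

/-- On the critical interval, the low distribution dominates the high one up to a factor `√2`. -/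
theorem HardConditions.smul_high_le_low (H : HardConditions n Db Dh Dl v₀ v₁ v₂ p Δ) {s : Set ℝ}
    (hs : MeasurableSet s) :
    ENNReal.ofReal (1 / √2) * Dh (s ∩ criticalInterval v₁ v₂)
      ≤ Dl (s ∩ criticalInterval v₁ v₂) := by
  have := H.dist_high.prob
  have := H.dist_low.prob
  have hm := hs.inter (measurableSet_criticalInterval v₁ v₂)
  calc ENNReal.ofReal (1 / √2) * Dh (s ∩ criticalInterval v₁ v₂)
      = ∫⁻ _ in s ∩ criticalInterval v₁ v₂, ENNReal.ofReal (1 / √2) ∂Dh := by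
        rw [setLIntegral_const]
    _ ≤ ∫⁻ v in s ∩ criticalInterval v₁ v₂, Dl.rnDeriv Dh v ∂Dh := by
        refine setLIntegral_mono_ae (Dl.measurable_rnDeriv Dh).aemeasurable ?_
        filter_upwards [H.density_ratio] with v hv hvs
        exact (hv hvs.2).1
    _ ≤ _ := Measure.setLIntegral_rnDeriv_le _

theorem HardConditions.exists_critical (H : HardConditions n Db Dh Dl v₀ v₁ v₂ p Δ) :
    ∃ v ∈ criticalInterval v₁ v₂, v₀ < v := by
  by_contra hcon
  push Not at hcon
  have : Dh (criticalInterval v₁ v₂) = 0 := by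
    have h : ∀ᵐ v ∂Dh, v ∉ criticalInterval v₁ v₂ := by
      filter_upwards [H.gap_high] with v hv hvc
      linarith [hv hvc, hcon v hvc, virtualValue_le_self Dh v, H.Δ_pos]
    simpa [ae_iff] using h
  have h2 := H.prob_critical.1
  rw [measureReal_def, this] at h2
  simp at h2
  linarith [H.p_pos]

/-- A threshold at which both value distributions may be truncated. -/
structure GoodThreshold (Dh Dl : Measure ℝ) (v₀ : ℝ) (v₁ : EReal) (v₂ B : ℝ) : Prop where
  base_lt : v₀ < B
  critical_lt : v₂ < B
  le_top : (B : EReal) ≤ v₁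
  noGap_high : NoGapAcross Dh B
  noGap_low : NoGapAcross Dl B

/-- There are good thresholds that exhaust the values. -/
theorem HardConditions.exists_thresholds (H : HardConditions n Db Dh Dl v₀ v₁ v₂ p Δ) :
    ∃ B : ℕ → ℝ, (∀ k, GoodThreshold Dh Dl v₀ v₁ v₂ (B k)) ∧
      (∀ v : ℝ, (v : EReal) < v₁ → ∀ᶠ k in Filter.atTop, v < B k) ∧
      (∀ᵐ v ∂Dh, ∀ᶠ k in Filter.atTop, v ≤ B k) ∧ (∀ᵐ v ∂Dl, ∀ᶠ k in Filter.atTop, v ≤ B k) := by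
  rcases H.v₁_top_or_pointmass with htop | ⟨w, hw, hwh, hwl, hh, hl⟩
  · subst htop
    have hcrit : criticalInterval ⊤ v₂ = Ici v₂ := by
      ext v; simp [criticalInterval, EReal.coe_lt_top]
    have hex : ∀ k : ℕ, ∃ B, (k : ℝ) ≤ B ∧ GoodThreshold Dh Dl v₀ ⊤ v₂ B := by
      intro k
      obtain ⟨B, hCB, hB⟩ := exists_threshold_ge Dh (max k (max (v₀ + 1) (v₂ + 1)))
      have h1 := (le_max_left _ _).trans hCB
      have h2 := ((le_max_left _ _).trans (le_max_right _ _)).trans hCB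
      have h3 := ((le_max_right _ _).trans (le_max_right _ _)).trans hCB
      refine ⟨B, h1, by linarith, by linarith, le_top, noGapAcross_of hB, noGapAcross_of ?_⟩
      have hsub : Ici B ⊆ Ici v₂ := Ici_subset_Ici.mpr (by linarith)
      rcases hB with hB | hB
      · left
        have := H.density_ac hB
        rwa [Measure.restrict_apply measurableSet_Ici, hcrit,
          inter_eq_self_of_subset_left hsub] at this
      · right
        intro w hw h0
        have := H.smul_high_le_low (s := Icc B w) measurableSet_Icc
        rw [hcrit, inter_eq_self_of_subset_left (Icc_subset_Ici_self.trans hsub), h0,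
          nonpos_iff_eq_zero, mul_eq_zero] at this
        rcases this with h | h
        · rw [ENNReal.ofReal_eq_zero] at h
          have : (0 : ℝ) < 1 / √2 := by positivity
          linarith
        · exact hB w hw h
    choose B hkB hB using hex
    have hlt : ∀ v : ℝ, ∀ᶠ k in Filter.atTop, v < B k := by
      intro v
      obtain ⟨K, hK⟩ := exists_nat_gt v
      filter_upwards [Filter.eventually_ge_atTop K] with k hk
      exact hK.trans_le ((Nat.cast_le.mpr hk).trans (hkB k))
    exact ⟨B, hB, fun v _ => hlt v,
      Filter.Eventually.of_forall fun v => (hlt v).mono fun k hk => hk.le,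
      Filter.Eventually.of_forall fun v => (hlt v).mono fun k hk => hk.le⟩
  · subst hw
    obtain ⟨v, hvc, hv⟩ := H.exists_critical
    have hvw : v < w := EReal.coe_lt_coe_iff.mp hvc.2
    have hgap : ∀ D : Measure ℝ, 0 < D {w} → NoGapAcross D w := fun D hD =>
      noGapAcross_of (Or.inr fun t ht h0 => hD.ne'
        (measure_mono_null (singleton_subset_iff.mpr (show w ∈ Icc w t from ⟨le_rfl, ht.le⟩)) h0))
    have hae : ∀ D : Measure ℝ, D (Ioi w) = 0 → ∀ᵐ v ∂D, ∀ᶠ _k : ℕ in Filter.atTop, v ≤ w := by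
      intro D hD
      have : ∀ᵐ v ∂D, v ≤ w := by
        rw [ae_iff]; simpa [not_le, Ioi_def] using hD
      filter_upwards [this] with v hv
      exact Filter.Eventually.of_forall fun _ => hv
    exact ⟨fun _ => w, fun _ => ⟨hv.trans hvw, hvc.1.trans_lt hvw, le_rfl, hgap Dh hwh,
        hgap Dl hwl⟩,
      fun v hv => Filter.Eventually.of_forall fun _ => EReal.coe_lt_coe_iff.mp hv,
      hae Dh hh, hae Dl hl⟩

end Hard

/-! ### The regret of a mechanism on a hard instance -/

/-- The member of the hard family in which the bidders `i ≠ 0` with `σ i = true` have the high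
distribution. -/
def hardInstance {n : ℕ} (Db Dh Dl : Measure ℝ) (σ : Fin n → Bool) (i : Fin n) : Measure ℝ :=
  if i.val = 0 then Db else if σ i then Dh else Dl

/-- The scores of the bidders in a hard instance. -/
def hardScore {n : ℕ} (Dh : Measure ℝ) (v₀ v₂ B : ℝ) (σ : Fin n → Bool) (i : Fin n) : ℝ → ℝ :=
  if i.val = 0 then baseScore v₀ else if σ i then highScore Dh v₂ B else lowScore B

/-- The profiles in which the value of bidder `i` lies in `U` and the values of all other bidders,
except bidder `0`, are below `v₂`. -/
def soleContender {n : ℕ} (U : Set ℝ) (v₂ : ℝ) (i : Fin n) : Set (Fin n → ℝ) :=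
  {w | w i ∈ U ∧ ∀ j, j ≠ i → j.val ≠ 0 → w j < v₂}

/-- The probability of the wrong decision about a sole contender who wins with probability `x`:
she should win if her distribution is high, and lose if it is low. -/
def mistake (high : Bool) (x : ℝ) : ℝ := if high then 1 - x else x

/-- The possible positions of the value `v` of a bidder with score `s` and truncated virtual value
`f`: not competing, the base bidder, a high value below the threshold, a value above the
threshold. -/
def ScoreClass (Dh : Measure ℝ) (T : Set ℝ) (v₀ B s f v : ℝ) : Prop :=
  (s = 0 ∧ f ≤ v₀) ∨ (s = 1 / 2 ∧ f = v₀) ∨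
    (v ∈ T ∧ s = 1 + Dh.real (Iic v) ∧ f = virtualValue Dh v ∧ v₀ ≤ f ∧ f ≤ B) ∨ (s = 3 ∧ f = B)

theorem measurableSet_soleContender {n : ℕ} {U : Set ℝ} (hU : MeasurableSet U) (v₂ : ℝ)
    (i : Fin n) : MeasurableSet (soleContender U v₂ i) := by
  have : soleContender U v₂ i = (fun w : Fin n → ℝ => w i) ⁻¹' U
      ∩ ⋂ j : {j : Fin n // j ≠ i ∧ j.val ≠ 0}, (fun w : Fin n → ℝ => w j) ⁻¹' Iio v₂ := by
    ext w
    simp [soleContender]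
  rw [this]
  exact (measurable_pi_apply i hU).inter
    (MeasurableSet.iInter fun j => measurable_pi_apply _ measurableSet_Iio)

/-- Virtual values are ordered as the scores of competing bidders. -/
theorem ScoreClass.le_of_le {Dh : Measure ℝ} [IsProbabilityMeasure Dh] {T : Set ℝ} {v₀ B : ℝ}
    (hT : ∀ v ∈ T, ∀ w ∈ T, Dh.real (Iic v) ≤ Dh.real (Iic w) →
      virtualValue Dh v ≤ virtualValue Dh w)
    (hB : v₀ ≤ B) {s f v s' f' v' : ℝ} (h : ScoreClass Dh T v₀ B s f v)
    (h' : ScoreClass Dh T v₀ B s' f' v') (hs : 1 / 2 ≤ s) (hle : s' ≤ s) : f' ≤ f := by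
  have hF : ∀ v, 0 ≤ Dh.real (Iic v) ∧ Dh.real (Iic v) ≤ 1 := fun v =>
    ⟨measureReal_nonneg, measureReal_le_one⟩
  have := hF v
  have := hF v'
  rcases h with ⟨a, b⟩ | ⟨a, b⟩ | ⟨a, b, c, d, e⟩ | ⟨a, b⟩ <;>
  rcases h' with ⟨a', b'⟩ | ⟨a', b'⟩ | ⟨a', b', c', d', e'⟩ | ⟨a', b'⟩ <;>
  first
  | linarith
  | (rw [c, c']; exact hT v' a' v a (by linarith))

theorem ScoreClass.base_le {Dh : Measure ℝ} {T : Set ℝ} {v₀ B : ℝ} (hB : v₀ ≤ B) {s f v : ℝ}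
    (h : ScoreClass Dh T v₀ B s f v) (hs : 1 / 2 ≤ s) : v₀ ≤ f := by
  rcases h with ⟨a, b⟩ | ⟨a, b⟩ | ⟨a, b, c, d, e⟩ | ⟨a, b⟩ <;> linarith

/-- If all bidders but `i` have virtual value at most `v₀`, an allocation `x` loses against the
optimum at least `Δ` times the probability of the wrong decision about `i`. -/
theorem virtual_regret_le {n : ℕ} {f x : Fin n → ℝ} {v₀ Δ m : ℝ} (hv₀ : 0 ≤ v₀)
    (hx0 : ∀ i, 0 ≤ x i) (hx1 : ∑ i, x i ≤ 1) (i : Fin n) (hother : ∀ j, j ≠ i → f j ≤ v₀)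
    (hm : v₀ ≤ m) (hmi : f i ≤ m) (high : Bool)
    (hi : if high then v₀ + Δ ≤ f i else f i + Δ ≤ v₀) :
    Δ * mistake high (x i) ≤ m - ∑ j, f j * x j := by
  have h1 : ∑ j, f j * x j ≤ f i * x i + v₀ * (1 - x i) := by
    rw [← Finset.add_sum_erase _ _ (Finset.mem_univ i)]
    rw [← Finset.add_sum_erase _ _ (Finset.mem_univ i)] at hx1
    have h2 : ∑ j ∈ Finset.univ.erase i, f j * x j ≤ v₀ * ∑ j ∈ Finset.univ.erase i, x j := by
      rw [Finset.mul_sum]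
      exact Finset.sum_le_sum fun j hj =>
        mul_le_mul_of_nonneg_right (hother j (Finset.ne_of_mem_erase hj)) (hx0 j)
    have h3 := mul_le_mul_of_nonneg_left (show ∑ j ∈ Finset.univ.erase i, x j ≤ 1 - x i by linarith)
      hv₀
    linarith
  have hxi : x i ≤ 1 := (Finset.single_le_sum (fun j _ => hx0 j) (Finset.mem_univ i)).trans hx1
  cases high with
  | true =>
    simp only [if_true, mistake] at *
    nlinarith [mul_le_mul_of_nonneg_right hi (sub_nonneg.mpr hxi)]
  | false =>
    simp only [Bool.false_eq_true, if_false, mistake] at *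
    nlinarith [mul_le_mul_of_nonneg_right hi (hx0 i)]

theorem virtual_regret_nonneg {n : ℕ} {f x : Fin n → ℝ} {m : ℝ} (hm0 : 0 ≤ m)
    (hx0 : ∀ i, 0 ≤ x i) (hx1 : ∑ i, x i ≤ 1) (hm : ∀ j, f j ≤ m) :
    0 ≤ m - ∑ j, f j * x j := by
  have h1 : ∑ j, f j * x j ≤ m * ∑ j, x j := by
    rw [Finset.mul_sum]
    exact Finset.sum_le_sum fun j _ => mul_le_mul_of_nonneg_right (hm j) (hx0 j)
  have h2 := mul_le_mul_of_nonneg_left hx1 hm0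
  linarith

theorem isValueDistribution_dirac {v₀ : ℝ} (hv₀ : 0 < v₀) :
    IsValueDistribution (Measure.dirac v₀) := by
  refine ⟨inferInstance, ?_, {v₀}, countable_singleton _, ?_⟩
  · simp [Measure.dirac_apply' _ measurableSet_Iio, hv₀.le]
  · have : (Measure.dirac v₀).restrict ({v₀} : Set ℝ)ᶜ = 0 := by
      rw [Measure.restrict_eq_zero]
      simp
    rw [this]
    exact Measure.AbsolutelyContinuous.zero _

section Hard

variable {n : ℕ} {Db Dh Dl : Measure ℝ} {v₀ : ℝ} {v₁ : EReal} {v₂ p Δ : ℝ}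

theorem HardConditions.isValueDistribution (H : HardConditions n Db Dh Dl v₀ v₁ v₂ p Δ)
    (σ : Fin n → Bool) (i : Fin n) : IsValueDistribution (hardInstance Db Dh Dl σ i) := by
  unfold hardInstance
  split_ifs
  · rw [H.base_pointmass]; exact isValueDistribution_dirac H.v₀_pos
  · exact H.dist_high
  · exact H.dist_low

theorem GoodThreshold.noGap (H : HardConditions n Db Dh Dl v₀ v₁ v₂ p Δ) {B : ℝ}
    (hB : GoodThreshold Dh Dl v₀ v₁ v₂ B) (σ : Fin n → Bool) (i : Fin n) :
    NoGapAcross (hardInstance Db Dh Dl σ i) B := by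
  unfold hardInstance
  split_ifs
  · rw [H.base_pointmass]
    refine noGapAcross_of (Or.inl ?_)
    simp [Measure.dirac_apply' _ measurableSet_Ici, hB.base_lt]
  · exact hB.noGap_high
  · exact hB.noGap_low

theorem HardConditions.measure_Iio_ne_zero (H : HardConditions n Db Dh Dl v₀ v₁ v₂ p Δ)
    (hn : 2 ≤ n) : Dh (Iio v₂) ≠ 0 := by
  have := H.dist_high.prob
  intro h0
  have h1 : Dh.real (Iio v₂) + Dh.real (Ici v₂) = 1 := by
    have := measureReal_add_measureReal_compl (μ := Dh) (measurableSet_Iio (a := v₂))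
    rwa [compl_Iio, probReal_univ] at this
  rw [measureReal_def, h0] at h1
  have h2 := H.prob_high_values.1
  have h3 : (1 : ℝ) / n ≤ 1 / 2 :=
    one_div_le_one_div_of_le (by norm_num) (by exact_mod_cast hn)
  simp at h1
  linarith

theorem HardConditions.monotone_hardScore (H : HardConditions n Db Dh Dl v₀ v₁ v₂ p Δ) (B : ℝ)
    (σ : Fin n → Bool) (i : Fin n) : Monotone (hardScore Dh v₀ v₂ B σ i) := by
  have := H.dist_high.prob
  unfold hardScore
  split_ifs
  · exact monotone_baseScore _
  · exact monotone_highScore _ _ _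
  · exact monotone_lowScore _

theorem GoodThreshold.hardScore_const {B : ℝ} (hB : GoodThreshold Dh Dl v₀ v₁ v₂ B)
    (σ : Fin n → Bool) (i : Fin n) (t : ℝ) (ht : B ≤ t) :
    hardScore Dh v₀ v₂ B σ i t = hardScore Dh v₀ v₂ B σ i B := by
  have h1 := hB.base_lt.le
  unfold hardScore
  split_ifs <;> simp [baseScore, highScore, lowScore, ht, h1, h1.trans ht]

theorem HardConditions.extracts (H : HardConditions n Db Dh Dl v₀ v₁ v₂ p Δ) (hn : 2 ≤ n) (B : ℝ)
    (σ : Fin n → Bool) (i : Fin n) :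
    ExtractsVirtualValue (hardInstance Db Dh Dl σ i) B (hardScore Dh v₀ v₂ B σ i) := by
  unfold hardInstance hardScore
  split_ifs
  · rw [H.base_pointmass]; exact extractsVirtualValue_baseScore
  · exact extractsVirtualValue_highScore H.dist_high H.regular_high (H.measure_Iio_ne_zero hn)
  · exact extractsVirtualValue_lowScore _ _

/-- Almost every value of a bidder is in one of the score classes. Values below `v₂` have virtual
value at most `v₀`, critical values one that differs from `v₀` by at least `Δ`. -/
theorem HardConditions.exists_scoreClass (H : HardConditions n Db Dh Dl v₀ v₁ v₂ p Δ) {B : ℝ}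
    (hB : GoodThreshold Dh Dl v₀ v₁ v₂ B) :
    ∃ T : Set ℝ, (∀ v ∈ T, ∀ w ∈ T, Dh.real (Iic v) ≤ Dh.real (Iic w) →
        virtualValue Dh v ≤ virtualValue Dh w) ∧
      ∀ (σ : Fin n → Bool) (i : Fin n), ∀ᵐ v ∂(hardInstance Db Dh Dl σ i),
        ScoreClass Dh T v₀ B (hardScore Dh v₀ v₂ B σ i v)
          (truncVirtualValue (hardInstance Db Dh Dl σ i) B v) v ∧
        (i.val = 0 → hardScore Dh v₀ v₂ B σ i v = 1 / 2) ∧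
        (i.val ≠ 0 → v < v₂ → truncVirtualValue (hardInstance Db Dh Dl σ i) B v ≤ v₀) ∧
        (i.val = 0 → truncVirtualValue (hardInstance Db Dh Dl σ i) B v ≤ v₀) ∧
        (i.val ≠ 0 → v ∈ Ico v₂ B →
          if σ i then v₀ + Δ ≤ truncVirtualValue (hardInstance Db Dh Dl σ i) B v
          else truncVirtualValue (hardInstance Db Dh Dl σ i) B v + Δ ≤ v₀) := by
  have := H.dist_high.prob
  have hcrit : ∀ v, v ∈ Ico v₂ B → v ∈ criticalInterval v₁ v₂ := fun v hv =>
    ⟨hv.1, (EReal.coe_lt_coe_iff.mpr hv.2).trans_le hB.le_top⟩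
  obtain ⟨S, hS0, hSm⟩ := H.regular_high.monotone
  refine ⟨S \ {v | ∃ w < v, Dh (Ioc w v) = 0}, ?_, fun σ i => ?_⟩
  · rintro v ⟨hvS, hvN⟩ w ⟨hwS, -⟩ hle
    rcases le_or_gt v w with h | h
    · exact hSm hvS hwS h
    · exfalso
      apply hvN
      refine ⟨w, h, ?_⟩
      have h1 : Dh.real (Iic v) = Dh.real (Iic w) + Dh.real (Ioc w v) := by
        rw [← Iic_union_Ioc_eq_Iic h.le,
          measureReal_union (by
            rw [Set.disjoint_left]; exact fun t ht ht' => not_lt.mpr ht ht'.1) measurableSet_Ioc]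
      have h2 : Dh.real (Ioc w v) = 0 := le_antisymm (by linarith) measureReal_nonneg
      exact (measureReal_eq_zero_iff).mp h2
  by_cases hi : i.val = 0
  · have e1 : hardInstance Db Dh Dl σ i = Measure.dirac v₀ := by
      simp [hardInstance, hi, H.base_pointmass]
    have e2 : hardScore Dh v₀ v₂ B σ i = baseScore v₀ := by simp [hardScore, hi]
    rw [e1, e2, ae_dirac_eq]
    have hφ : truncVirtualValue (Measure.dirac v₀) B v₀ = v₀ := by
      rw [truncVirtualValue, if_pos hB.base_lt, virtualValue]
      simp [measureReal_def, Measure.dirac_apply' _ measurableSet_Ioi]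
    have hs : baseScore v₀ v₀ = 1 / 2 := by simp [baseScore]
    simp only [Filter.eventually_pure]
    rw [hφ, hs]
    exact ⟨Or.inr (Or.inl ⟨rfl, rfl⟩), fun _ => rfl, fun h => absurd hi h, fun _ => le_rfl,
      fun h => absurd hi h⟩
  by_cases hσ : σ i
  · have e1 : hardInstance Db Dh Dl σ i = Dh := by simp [hardInstance, hi, hσ]
    have e2 : hardScore Dh v₀ v₂ B σ i = highScore Dh v₂ B := by simp [hardScore, hi, hσ]
    rw [e1, e2]
    have hN : ∀ᵐ v ∂Dh, ¬ ∃ w < v, Dh (Ioc w v) = 0 := by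
      rw [ae_iff]; simpa using measure_setOf_exists_Ioc_eq_zero Dh
    have hv₂ : ∀ᵐ v ∂Dh, v = v₂ → Dh {v₂} ≠ 0 := by
      by_cases h : Dh {v₂} = 0
      · filter_upwards [measure_eq_zero_iff_ae_notMem.mp h] with v hv hv'
        exact absurd hv' hv
      · exact Filter.Eventually.of_forall fun _ _ => h
    filter_upwards [H.gap_high, H.small_high, measure_eq_zero_iff_ae_notMem.mp hS0, hN, hv₂]
      with v hg hsm hvS hvN hvv₂
    have hlt : v < v₂ → truncVirtualValue Dh B v ≤ v₀ := by
      intro h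
      rw [truncVirtualValue, if_pos (h.trans hB.critical_lt)]
      exact hsm h
    have hmid : v ∈ Ico v₂ B → v₀ + Δ ≤ truncVirtualValue Dh B v := by
      intro h
      rw [truncVirtualValue, if_pos h.2]
      linarith [hg (hcrit v h)]
    refine ⟨?_, fun h => absurd h hi, fun _ => hlt, fun h => absurd h hi, fun _ h => ?_⟩
    · rcases le_or_gt B v with hBv | hBv
      · exact Or.inr (Or.inr (Or.inr ⟨by simp [highScore, hBv],
          by simp [truncVirtualValue, not_lt.mpr hBv]⟩))
      rcases lt_or_ge v v₂ with hv | hv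
      · refine Or.inl ⟨?_, hlt hv⟩
        have : Dh.real (Iic v) ≤ Dh.real (Iio v₂) :=
          measureReal_mono fun t ht => lt_of_le_of_lt ht hv
        simp [highScore, not_le.mpr hBv, not_lt.mpr this]
      · refine Or.inr (Or.inr (Or.inl ⟨⟨not_not.mp hvS, hvN⟩, ?_, ?_, ?_, ?_⟩))
        · have hpos : Dh (Icc v₂ v) ≠ 0 := by
            rcases hv.eq_or_lt with h | h
            · subst h; simpa using hvv₂ rfl
            · exact fun h0 => hvN ⟨v₂, h, measure_mono_null Ioc_subset_Icc_self h0⟩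
          have h1 : Dh.real (Iic v) = Dh.real (Iio v₂) + Dh.real (Icc v₂ v) := by
            rw [← Iio_union_Icc_eq_Iic hv, measureReal_union (by
              rw [Set.disjoint_left]; exact fun t ht ht' => not_le.mpr ht ht'.1)
              measurableSet_Icc]
          have h2 : 0 < Dh.real (Icc v₂ v) := ENNReal.toReal_pos hpos (measure_ne_top _ _)
          have h3 : Dh.real (Iio v₂) < Dh.real (Iic v) := by linarith
          simp [highScore, not_le.mpr hBv, h3]
        · simp [truncVirtualValue, hBv]
        · linarith [hmid ⟨hv, hBv⟩, H.Δ_pos]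
        · rw [truncVirtualValue, if_pos hBv]
          linarith [virtualValue_le_self Dh v]
    · simpa [hσ] using hmid h
  · have e1 : hardInstance Db Dh Dl σ i = Dl := by simp [hardInstance, hi, hσ]
    have e2 : hardScore Dh v₀ v₂ B σ i = lowScore B := by simp [hardScore, hi, hσ]
    rw [e1, e2]
    filter_upwards [H.gap_low, H.small_low] with v hg hsm
    have hlt : v < v₂ → truncVirtualValue Dl B v ≤ v₀ := by
      intro h
      rw [truncVirtualValue, if_pos (h.trans hB.critical_lt)]
      exact hsm h
    have hmid : v ∈ Ico v₂ B → truncVirtualValue Dl B v + Δ ≤ v₀ := by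
      intro h
      rw [truncVirtualValue, if_pos h.2]
      exact hg (hcrit v h)
    refine ⟨?_, fun h => absurd h hi, fun _ => hlt, fun h => absurd h hi, fun _ h => ?_⟩
    · rcases le_or_gt B v with hBv | hBv
      · exact Or.inr (Or.inr (Or.inr ⟨by simp [lowScore, hBv],
          by simp [truncVirtualValue, not_lt.mpr hBv]⟩))
      · refine Or.inl ⟨by simp [lowScore, not_le.mpr hBv], ?_⟩
        rcases lt_or_ge v v₂ with hv | hv
        · exact hlt hv
        · linarith [hmid ⟨hv, hBv⟩, H.Δ_pos]
    · simpa [hσ] using hmid h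

/-- The winner under the scores maximizes the virtual value; every other allocation loses at least
`Δ` per wrong decision about a sole contender. -/
theorem HardConditions.ae_virtual_regret (H : HardConditions n Db Dh Dl v₀ v₁ v₂ p Δ) (hn : 2 ≤ n)
    {B : ℝ} (hB : GoodThreshold Dh Dl v₀ v₁ v₂ B) (σ : Fin n → Bool) (M : Mechanism n) :
    ∀ᵐ w ∂(Measure.pi (hardInstance Db Dh Dl σ)),
      Δ * ∑ i ∈ Finset.univ.filter (fun i : Fin n => i.val ≠ 0),
          (soleContender (Ico v₂ B) v₂ i).indicator (fun w => mistake (σ i) (M.alloc w i)) w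
        ≤ ∑ i, truncVirtualValue (hardInstance Db Dh Dl σ i) B (w i)
              * scoreAlloc (hardScore Dh v₀ v₂ B σ) w i
          - ∑ i, truncVirtualValue (hardInstance Db Dh Dl σ i) B (w i) * M.alloc w i := by
  have hD := H.isValueDistribution σ
  have hprob := fun i => (hD i).prob
  have := H.dist_high.prob
  obtain ⟨T, hT, hcl⟩ := H.exists_scoreClass hB
  filter_upwards [ae_pi_nonneg _ hD, ae_pi_of_ae (hardInstance Db Dh Dl σ) (hcl σ)] with w hw0 hw
  set f : Fin n → ℝ := fun i => truncVirtualValue (hardInstance Db Dh Dl σ i) B (w i) with hf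
  set s := hardScore Dh v₀ v₂ B σ with hs
  have hz : s ⟨0, by omega⟩ (w ⟨0, by omega⟩) = 1 / 2 := (hw ⟨0, by omega⟩).2.1 rfl
  obtain ⟨k, hk⟩ := exists_wins (s := s) (b := w) (k := ⟨0, by omega⟩) (by rw [hz]; norm_num)
  have hle : ∀ j, s j (w j) ≤ s k (w k) := by
    intro j
    by_cases h : j = k
    · rw [h]
    · exact (hk.2 j h).1
  have hhalf : 1 / 2 ≤ s k (w k) := hz ▸ hle ⟨0, by omega⟩
  have hmax : ∀ j, f j ≤ f k := fun j =>
    (hw k).1.le_of_le hT hB.base_lt.le (hw j).1 hhalf (hle j)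
  have hbase : v₀ ≤ f k := (hw k).1.base_le hB.base_lt.le hhalf
  have hsum : ∑ i, f i * scoreAlloc s w i = f k := by
    simp [hk.scoreAlloc_eq]
  have hx0 := M.alloc_nonneg w hw0
  have hx1 := M.alloc_sum_le_one w hw0
  change Δ * _ ≤ ∑ i, f i * scoreAlloc s w i - ∑ i, f i * M.alloc w i
  rw [hsum]
  by_cases hex : ∃ i : Fin n, i.val ≠ 0 ∧ w ∈ soleContender (Ico v₂ B) v₂ i
  · obtain ⟨i, hi0, hi⟩ := hex
    rw [Finset.sum_eq_single i]
    · rw [indicator_of_mem hi]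
      refine virtual_regret_le H.v₀_pos.le hx0 hx1 i (fun j hj => ?_) hbase (hmax i) (σ i)
        ((hw i).2.2.2.2 hi0 hi.1)
      by_cases hj0 : j.val = 0
      · exact (hw j).2.2.2.1 hj0
      · exact (hw j).2.2.1 hj0 (hi.2 j hj hj0)
    · intro j hj hji
      refine indicator_of_notMem (fun hj' => ?_) _
      exact absurd hj'.1.1 (not_le.mpr (hi.2 j hji (Finset.mem_filter.mp hj).2))
    · intro h
      simp [hi0] at h
  · rw [Finset.sum_eq_zero, mul_zero]
    · exact virtual_regret_nonneg (H.v₀_pos.le.trans hbase) hx0 hx1 hmax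
    · intro i hi
      exact indicator_of_notMem (fun h => hex ⟨i, (Finset.mem_filter.mp hi).2, h⟩) _

end Hard

/-- The expected number of wrong decisions of `M` about bidder `i` as sole contender. -/
def mistakeMass {n : ℕ} (M : Mechanism n) (D : Fin n → Measure ℝ) (high : Bool) (U : Set ℝ)
    (v₂ : ℝ) (i : Fin n) : ℝ :=
  ∫ w, (soleContender U v₂ i).indicator (fun w => mistake high (M.alloc w i)) w ∂(Measure.pi D)

theorem measurable_mistake (high : Bool) : Measurable (mistake high) := by
  cases high
  · exact measurable_id
  · exact measurable_const.sub measurable_id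

theorem mistake_mem_unit (high : Bool) {x : ℝ} (h0 : 0 ≤ x) (h1 : x ≤ 1) :
    0 ≤ mistake high x ∧ mistake high x ≤ 1 := by
  cases high <;> simp [mistake] <;> constructor <;> linarith

section Hard

variable {n : ℕ} {Db Dh Dl : Measure ℝ} {v₀ : ℝ} {v₁ : EReal} {v₂ p Δ : ℝ}

theorem measurable_mistake_indicator (M : Mechanism n) (high : Bool) {U : Set ℝ}
    (hU : MeasurableSet U) (v₂ : ℝ) (i : Fin n) :
    Measurable fun w => (soleContender U v₂ i).indicator
      (fun w => mistake high (M.alloc w i)) w :=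
  ((measurable_mistake high).comp (M.measurable_alloc i)).indicator
    (measurableSet_soleContender hU v₂ i)

theorem ae_norm_mistake_indicator_le (M : Mechanism n) {D : Fin n → Measure ℝ}
    (hD : ∀ i, IsValueDistribution (D i)) (high : Bool) (U : Set ℝ) (v₂ : ℝ) (i : Fin n) :
    ∀ᵐ w ∂(Measure.pi D),
      ‖(soleContender U v₂ i).indicator (fun w => mistake high (M.alloc w i)) w‖ ≤ 1 := by
  filter_upwards [ae_pi_nonneg D hD] with w hw
  have h := mistake_mem_unit high (M.alloc_nonneg w hw i) (M.alloc_le_one hw i)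
  by_cases hwm : w ∈ soleContender U v₂ i
  · rw [indicator_of_mem hwm, Real.norm_eq_abs, abs_of_nonneg h.1]
    exact h.2
  · rw [indicator_of_notMem hwm]
    simp

theorem integrable_mistake_indicator (M : Mechanism n) {D : Fin n → Measure ℝ}
    (hD : ∀ i, IsValueDistribution (D i)) (high : Bool) {U : Set ℝ} (hU : MeasurableSet U)
    (v₂ : ℝ) (i : Fin n) :
    Integrable (fun w => (soleContender U v₂ i).indicator
      (fun w => mistake high (M.alloc w i)) w) (Measure.pi D) := by
  have := fun i => (hD i).prob
  exact Integrable.mono' (integrable_const 1)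
    (measurable_mistake_indicator M high hU v₂ i).aestronglyMeasurable
    (ae_norm_mistake_indicator_le M hD high U v₂ i)

/-- The regret bound at a fixed truncation. -/
theorem HardConditions.regret_at_threshold (H : HardConditions n Db Dh Dl v₀ v₁ v₂ p Δ)
    (hn : 2 ≤ n) {B : ℝ} (hB : GoodThreshold Dh Dl v₀ v₁ v₂ B) (σ : Fin n → Bool) {M : Mechanism n}
    (hM : IsBIC M (hardInstance Db Dh Dl σ)) {loss : ℝ}
    (hloss : optRevenue (hardInstance Db Dh Dl σ) - (loss : EReal)
      ≤ (revenue M (hardInstance Db Dh Dl σ) : EReal)) :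
    Δ * ∑ i ∈ Finset.univ.filter (fun i : Fin n => i.val ≠ 0),
        mistakeMass M (hardInstance Db Dh Dl σ) (σ i) (Ico v₂ B) v₂ i
      ≤ loss + ∑ i, ∫ v in Ioi B, (interimPay M (hardInstance Db Dh Dl σ) i v
          - interimPay M (hardInstance Db Dh Dl σ) i 0) ∂(hardInstance Db Dh Dl σ i) := by
  have hD := H.isValueDistribution σ
  have hprob := fun i => (hD i).prob
  have hB0 : 0 ≤ B := (H.v₀_pos.trans hB.base_lt).le
  have hreg := H.ae_virtual_regret hn hB σ M
  have hext := H.extracts hn B σ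
  have hgap := hB.noGap H σ
  have hs := H.monotone_hardScore B σ
  have hconst := hB.hardScore_const σ
  set D := hardInstance Db Dh Dl σ with hDdef
  set s := hardScore Dh v₀ v₂ B σ with hsdef
  have hM' := isBIC_scoreMechanism hD hs hB0 hconst
  have hopt : (revenue (scoreMechanism s hs B) D : EReal) ≤ optRevenue D :=
    le_iSup₂_of_le _ hM' le_rfl
  have h1 : revenue (scoreMechanism s hs B) D - loss ≤ revenue M D := by
    have := (EReal.sub_le_sub hopt (le_refl (loss : EReal))).trans hloss
    exact_mod_cast this
  have h2 : revenue M D = ∑ i, ∫ w, M.pay w i ∂(Measure.pi D) :=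
    integral_finsetSum _ fun i _ => hM.integrable_pay i
  have h3 : revenue (scoreMechanism s hs B) D = ∑ i, ∫ w, scorePay s B w i ∂(Measure.pi D) :=
    integral_finsetSum _ fun i _ => hM'.integrable_pay i
  have h4 : ∑ i, ∫ w, M.pay w i ∂(Measure.pi D)
      ≤ ∑ i, ∫ w, truncVirtualValue (D i) B (w i) * M.alloc w i ∂(Measure.pi D)
        + ∑ i, ∫ v in Ioi B, (interimPay M D i v - interimPay M D i 0) ∂(D i) := by
    rw [← Finset.sum_add_distrib]
    exact Finset.sum_le_sum fun i _ => integral_pay_le M D hD i hM hB0 (hgap i)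
  have h5 : ∑ i, ∫ w, truncVirtualValue (D i) B (w i) * scoreAlloc s w i ∂(Measure.pi D)
      ≤ ∑ i, ∫ w, scorePay s B w i ∂(Measure.pi D) :=
    Finset.sum_le_sum fun i _ => le_integral_scorePay hD hs hB0 i (hgap i) (hext i)
  have i1 : ∀ i, Integrable (fun w => truncVirtualValue (D i) B (w i) * M.alloc w i)
      (Measure.pi D) := fun i => integrable_truncVirtualValue_mul_alloc M D hD i hB0 (hgap i)
  have i2 : ∀ i, Integrable (fun w => truncVirtualValue (D i) B (w i) * scoreAlloc s w i)
      (Measure.pi D) := fun i =>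
    integrable_truncVirtualValue_mul_alloc (scoreMechanism s hs B) D hD i hB0 (hgap i)
  have i3 : ∀ i, Integrable (fun w => (soleContender (Ico v₂ B) v₂ i).indicator
      (fun w => mistake (σ i) (M.alloc w i)) w) (Measure.pi D) := fun i =>
    integrable_mistake_indicator M hD (σ i) measurableSet_Ico v₂ i
  have h6 := integral_mono_ae ((integrable_finsetSum _ fun i _ => i3 i).const_mul Δ)
    ((integrable_finsetSum _ fun i _ => i2 i).sub (integrable_finsetSum _ fun i _ => i1 i)) hreg
  rw [integral_const_mul, integral_finsetSum _ fun i _ => i3 i] at h6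
  have h7 : ∫ w, (∑ i, truncVirtualValue (D i) B (w i) * scoreAlloc s w i
      - ∑ i, truncVirtualValue (D i) B (w i) * M.alloc w i) ∂(Measure.pi D)
      = ∑ i, ∫ w, truncVirtualValue (D i) B (w i) * scoreAlloc s w i ∂(Measure.pi D)
        - ∑ i, ∫ w, truncVirtualValue (D i) B (w i) * M.alloc w i ∂(Measure.pi D) := by
    rw [integral_sub (integrable_finsetSum _ fun i _ => i2 i)
      (integrable_finsetSum _ fun i _ => i1 i), integral_finsetSum _ fun i _ => i2 i,
      integral_finsetSum _ fun i _ => i1 i]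
  have h8 := h6.trans_eq h7
  unfold mistakeMass
  linarith

/-- A nearly optimal mechanism makes few mistakes about sole contenders. -/
theorem HardConditions.regret_le (H : HardConditions n Db Dh Dl v₀ v₁ v₂ p Δ)
    (hn : 2 ≤ n) (σ : Fin n → Bool) {M : Mechanism n}
    (hM : IsBIC M (hardInstance Db Dh Dl σ)) {loss : ℝ}
    (hloss : optRevenue (hardInstance Db Dh Dl σ) - (loss : EReal)
      ≤ (revenue M (hardInstance Db Dh Dl σ) : EReal)) :
    Δ * ∑ i ∈ Finset.univ.filter (fun i : Fin n => i.val ≠ 0),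
        mistakeMass M (hardInstance Db Dh Dl σ) (σ i) (criticalInterval v₁ v₂) v₂ i ≤ loss := by
  have hD := H.isValueDistribution σ
  have hprob := fun i => (hD i).prob
  obtain ⟨B, hB, hBcrit, hBh, hBl⟩ := H.exists_thresholds
  have hBae : ∀ i, ∀ᵐ v ∂(hardInstance Db Dh Dl σ i), ∀ᶠ k in Filter.atTop, v ≤ B k := by
    intro i
    unfold hardInstance
    split_ifs
    · rw [H.base_pointmass, ae_dirac_eq, Filter.eventually_pure]
      exact Filter.Eventually.of_forall fun k => (hB k).base_lt.le
    · exact hBh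
    · exact hBl
  have hk := fun k => H.regret_at_threshold hn (hB k) σ hM hloss
  set D := hardInstance Db Dh Dl σ with hDdef
  have t1 : ∀ i, Filter.Tendsto (fun k => ∫ v in Ioi (B k), (interimPay M D i v
      - interimPay M D i 0) ∂(D i)) Filter.atTop (nhds 0) := by
    intro i
    have hP : Integrable (fun v => interimPay M D i v - interimPay M D i 0) (D i) :=
      (integrable_integral_update D i (hM.integrable_pay i)).sub (integrable_const _)
    simp_rw [← integral_indicator measurableSet_Ioi]
    suffices h : Filter.Tendsto (fun k => ∫ v, (Ioi (B k)).indicator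
        (fun v => interimPay M D i v - interimPay M D i 0) v ∂(D i)) Filter.atTop
        (nhds (∫ _, (0 : ℝ) ∂(D i))) by simpa using h
    refine tendsto_integral_of_dominated_convergence
      (fun v => ‖interimPay M D i v - interimPay M D i 0‖)
      (fun k => (hP.indicator measurableSet_Ioi).aestronglyMeasurable) hP.norm
      (fun k => Filter.Eventually.of_forall fun v => norm_indicator_le_norm_self _ _) ?_
    filter_upwards [hBae i] with v hv
    refine tendsto_const_nhds.congr' ?_
    filter_upwards [hv] with k hk
    rw [indicator_of_notMem (by simpa using hk)]
  have t2 : ∀ i, Filter.Tendsto (fun k => mistakeMass M D (σ i) (Ico v₂ (B k)) v₂ i) Filter.atTop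
      (nhds (mistakeMass M D (σ i) (criticalInterval v₁ v₂) v₂ i)) := by
    intro i
    refine tendsto_integral_of_dominated_convergence (fun _ => 1)
      (fun k => (measurable_mistake_indicator M (σ i) measurableSet_Ico v₂ i).aestronglyMeasurable)
      (integrable_const _) (fun k => ae_norm_mistake_indicator_le M hD (σ i) _ v₂ i) ?_
    refine Filter.Eventually.of_forall fun w => ?_
    refine tendsto_const_nhds.congr' ?_
    by_cases hw : (w i : EReal) < v₁
    · filter_upwards [hBcrit (w i) hw] with k hk
      have : w ∈ soleContender (criticalInterval v₁ v₂) v₂ i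
          ↔ w ∈ soleContender (Ico v₂ (B k)) v₂ i := by
        simp [soleContender, criticalInterval, hw, hk]
      by_cases hm : w ∈ soleContender (Ico v₂ (B k)) v₂ i
      · rw [indicator_of_mem hm, indicator_of_mem (this.mpr hm)]
      · rw [indicator_of_notMem hm, indicator_of_notMem (fun h => hm (this.mp h))]
    · refine Filter.Eventually.of_forall fun k => ?_
      have hk : B k ≤ w i := EReal.coe_le_coe_iff.mp ((hB k).le_top.trans (not_lt.mp hw))
      have e1 : w ∉ soleContender (criticalInterval v₁ v₂) v₂ i := fun h => hw h.1.2
      have e2 : w ∉ soleContender (Ico v₂ (B k)) v₂ i := fun h => not_lt.mpr hk h.1.2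
      exact (indicator_of_notMem e1 _).trans (indicator_of_notMem e2 _).symm
  have t3 := (tendsto_finsetSum (Finset.univ.filter fun i : Fin n => i.val ≠ 0)
    fun i _ => t2 i).const_mul Δ
  have t4 := (tendsto_finsetSum Finset.univ fun i _ => t1 i).const_add loss
  simp only [Finset.sum_const_zero, add_zero] at t4
  exact le_of_tendsto_of_tendsto' t3 t4 hk

end Hard

/-! ### Mistakes on neighbouring instances -/

/-- The profiles in which all bidders except `i` and `0` have values below `v₂`. -/
def othersBelow {n : ℕ} (v₂ : ℝ) (i : Fin n) : Set (Fin n → ℝ) :=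
  {w | ∀ j, j ≠ i → j.val ≠ 0 → w j < v₂}

theorem measurableSet_othersBelow {n : ℕ} (v₂ : ℝ) (i : Fin n) :
    MeasurableSet (othersBelow v₂ i) := by
  have := measurableSet_soleContender MeasurableSet.univ v₂ i
  simpa [soleContender, othersBelow] using this

theorem update_mem_soleContender_iff {n : ℕ} {U : Set ℝ} {v₂ : ℝ} {i : Fin n} {w : Fin n → ℝ}
    {v : ℝ} : Function.update w i v ∈ soleContender U v₂ i ↔ w ∈ othersBelow v₂ i ∧ v ∈ U := by
  simp only [soleContender, othersBelow, mem_ofPred_eq, Function.update_self]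
  rw [and_comm]
  refine and_congr_left fun _ => forall_congr' fun j => forall_congr' fun hj => ?_
  rw [Function.update_of_ne hj]

/-- The mistakes about bidder `i` when her value is drawn from `ν` and the other values from `D`. -/
theorem ofReal_mistakeMass_update {n : ℕ} (M : Mechanism n) (D : Fin n → Measure ℝ)
    [∀ i, IsProbabilityMeasure (D i)] (i : Fin n) (ν : Measure ℝ) [IsProbabilityMeasure ν]
    (hD : ∀ j, IsValueDistribution (Function.update D i ν j)) (high : Bool) {U : Set ℝ}
    (hU : MeasurableSet U) (v₂ : ℝ) :
    ENNReal.ofReal (mistakeMass M (Function.update D i ν) high U v₂ i)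
      = ∫⁻ w in othersBelow v₂ i, (∫⁻ v in U,
          ENNReal.ofReal (mistake high (M.alloc (Function.update w i v) i)) ∂ν)
          ∂(Measure.pi D) := by
  have hm := measurable_mistake_indicator M high hU v₂ i
  have hnn : 0 ≤ᵐ[Measure.pi (Function.update D i ν)] fun w => (soleContender U v₂ i).indicator
      (fun w => mistake high (M.alloc w i)) w := by
    filter_upwards [ae_pi_nonneg _ hD] with w hw
    refine indicator_apply_nonneg fun _ => ?_
    exact (mistake_mem_unit high (M.alloc_nonneg w hw i) (M.alloc_le_one hw i)).1
  have hm2 : Measurable fun z : (Fin n → ℝ) × ℝ => ENNReal.ofReal ((soleContender U v₂ i).indicator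
      (fun w => mistake high (M.alloc w i)) (Function.update z.1 i z.2)) :=
    hm.ennreal_ofReal.comp (measurable_update_uncurry i)
  rw [mistakeMass, ofReal_integral_eq_lintegral_ofReal
    (integrable_mistake_indicator M hD high hU v₂ i) hnn, pi_update_eq_map D i ν,
    lintegral_map hm.ennreal_ofReal (measurable_update_uncurry i),
    lintegral_prod _ hm2.aemeasurable,
    ← lintegral_indicator (measurableSet_othersBelow v₂ i)]
  refine lintegral_congr fun w => ?_
  by_cases hw : w ∈ othersBelow v₂ i
  · rw [indicator_of_mem hw, ← lintegral_indicator hU]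
    refine lintegral_congr fun v => ?_
    by_cases hv : v ∈ U
    · rw [indicator_of_mem hv, indicator_of_mem (update_mem_soleContender_iff.mpr ⟨hw, hv⟩)]
    · rw [indicator_of_notMem hv,
        indicator_of_notMem fun h => hv (update_mem_soleContender_iff.mp h).2]
      simp
  · rw [indicator_of_notMem hw]
    refine (lintegral_congr fun v => ?_).trans lintegral_zero
    rw [indicator_of_notMem fun h => hw (update_mem_soleContender_iff.mp h).1]
    simp

theorem one_third_le_pow {n : ℕ} (hn : 2 ≤ n) : (1 / 3 : ℝ) ≤ (1 - 1 / n) ^ (n - 1) := by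
  obtain ⟨k, rfl⟩ : ∃ k, n = k + 2 := ⟨n - 2, by omega⟩
  have hk : (0 : ℝ) < (k : ℝ) + 1 := by positivity
  have e1 : (1 - 1 / ((k + 2 : ℕ) : ℝ)) = (1 + 1 / ((k : ℝ) + 1))⁻¹ := by
    push_cast
    field_simp
    ring
  have e2 : (1 + 1 / ((k : ℝ) + 1)) ^ (k + 1) ≤ 3 := by
    calc (1 + 1 / ((k : ℝ) + 1)) ^ (k + 1) ≤ (Real.exp (1 / ((k : ℝ) + 1))) ^ (k + 1) := by
          gcongr
          linarith [Real.add_one_le_exp (1 / ((k : ℝ) + 1))]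
      _ = Real.exp 1 := by
          rw [← Real.exp_nat_mul]
          congr 1
          push_cast
          field_simp
      _ ≤ 3 := by linarith [Real.exp_one_lt_d9]
  rw [e1, show k + 2 - 1 = k + 1 from rfl, inv_pow, one_div]
  exact inv_anti₀ (by positivity) e2

section Hard

variable {n : ℕ} {Db Dh Dl : Measure ℝ} {v₀ : ℝ} {v₁ : EReal} {v₂ p Δ : ℝ}

theorem hardInstance_update {σ : Fin n → Bool} {i : Fin n} (hi : i.val ≠ 0) (b : Bool) :
    hardInstance Db Dh Dl (Function.update σ i b)
      = Function.update (hardInstance Db Dh Dl σ) i (if b then Dh else Dl) := by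
  funext j
  by_cases hj : j = i
  · subst hj; simp [hardInstance, hi]
  · simp [hardInstance, Function.update_of_ne hj]

theorem HardConditions.measureReal_Iio_ge (H : HardConditions n Db Dh Dl v₀ v₁ v₂ p Δ)
    {D : Measure ℝ} (hD : D = Dh ∨ D = Dl) : 1 - 1 / (n : ℝ) ≤ D.real (Iio v₂) := by
  have hval : IsProbabilityMeasure D ∧ D.real (Ici v₂) ≤ 1 / n := by
    rcases hD with rfl | rfl
    · exact ⟨H.dist_high.prob, H.prob_high_values.1⟩
    · exact ⟨H.dist_low.prob, H.prob_high_values.2⟩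
  have := hval.1
  have h1 := measureReal_add_measureReal_compl (μ := D) (measurableSet_Iio (a := v₂))
  rw [compl_Iio, probReal_univ] at h1
  linarith [hval.2]

/-- With probability at least `1/3`, all other bidders have values below `v₂`. -/
theorem HardConditions.one_third_le_othersBelow (H : HardConditions n Db Dh Dl v₀ v₁ v₂ p Δ)
    (hn : 2 ≤ n) (σ : Fin n → Bool) (i : Fin n) :
    ENNReal.ofReal (1 / 3) ≤ Measure.pi (hardInstance Db Dh Dl σ) (othersBelow v₂ i) := by
  have hprob := fun i => (H.isValueDistribution σ i).prob
  have hset : othersBelow v₂ i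
      = univ.pi fun j : Fin n => if j ≠ i ∧ j.val ≠ 0 then Iio v₂ else univ := by
    ext w
    simp only [othersBelow, mem_ofPred_eq, mem_pi, mem_univ, true_imp_iff]
    refine forall_congr' fun j => ?_
    by_cases h1 : j = i <;> by_cases h2 : j.val = 0 <;> simp [h1, h2]
  rw [hset, Measure.pi_pi, ← Finset.mul_prod_erase _ _ (Finset.mem_univ i)]
  simp only [ne_eq, not_true_eq_false, false_and, if_false, measure_univ, one_mul]
  have hnn : (0 : ℝ) ≤ 1 - 1 / n := by
    have : (1 : ℝ) / n ≤ 1 := by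
      rw [div_le_one (by positivity)]
      exact_mod_cast (by omega : 1 ≤ n)
    linarith
  calc ENNReal.ofReal (1 / 3) ≤ ENNReal.ofReal ((1 - 1 / n) ^ (n - 1)) :=
        ENNReal.ofReal_le_ofReal (one_third_le_pow hn)
    _ = ∏ _j ∈ Finset.univ.erase i, ENNReal.ofReal (1 - 1 / n) := by
        rw [Finset.prod_const, Finset.card_erase_of_mem (Finset.mem_univ i), Finset.card_univ,
          Fintype.card_fin, ENNReal.ofReal_pow hnn]
    _ ≤ _ := by
        refine Finset.prod_le_prod' fun j hj => ?_
        split_ifs with h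
        · rw [← ofReal_measureReal]
          refine ENNReal.ofReal_le_ofReal (H.measureReal_Iio_ge ?_)
          unfold hardInstance
          rw [if_neg h.2]
          split_ifs
          · exact Or.inl rfl
          · exact Or.inr rfl
        · rw [measure_univ, ← ENNReal.ofReal_one]
          refine ENNReal.ofReal_le_ofReal ?_
          have : (0 : ℝ) ≤ 1 / n := by positivity
          linarith

theorem HardConditions.smul_restrict_le (H : HardConditions n Db Dh Dl v₀ v₁ v₂ p Δ) :
    ENNReal.ofReal (1 / √2) • Dh.restrict (criticalInterval v₁ v₂)
      ≤ Dl.restrict (criticalInterval v₁ v₂) := by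
  refine Measure.le_iff.mpr fun s hs => ?_
  rw [Measure.smul_apply, Measure.restrict_apply hs, Measure.restrict_apply hs, smul_eq_mul]
  exact H.smul_high_le_low hs

/-- A mechanism cannot decide correctly about bidder `i` on both of two instances that differ in
her distribution only. -/
theorem HardConditions.mistakeMass_add_ge (H : HardConditions n Db Dh Dl v₀ v₁ v₂ p Δ)
    (hn : 2 ≤ n) (σ : Fin n → Bool) {i : Fin n} (hi : i.val ≠ 0) (M : Mechanism n) :
    p / 5 ≤ mistakeMass M (hardInstance Db Dh Dl (Function.update σ i true)) true
        (criticalInterval v₁ v₂) v₂ i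
      + mistakeMass M (hardInstance Db Dh Dl (Function.update σ i false)) false
        (criticalInterval v₁ v₂) v₂ i := by
  have hprob := fun i => (H.isValueDistribution σ i).prob
  have := H.dist_high.prob
  have := H.dist_low.prob
  have hcm := measurableSet_criticalInterval v₁ v₂
  have hDt := H.isValueDistribution (Function.update σ i true)
  have hDf := H.isValueDistribution (Function.update σ i false)
  have hnn : ∀ b : Bool, 0 ≤ mistakeMass M (hardInstance Db Dh Dl (Function.update σ i b)) b
      (criticalInterval v₁ v₂) v₂ i := by
    intro b
    refine integral_nonneg_of_ae ?_
    filter_upwards [ae_pi_nonneg _ (H.isValueDistribution (Function.update σ i b))] with w hw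
    refine indicator_apply_nonneg fun _ => ?_
    exact (mistake_mem_unit b (M.alloc_nonneg w hw i) (M.alloc_le_one hw i)).1
  have ht0 := hnn true
  have hf0 := hnn false
  rw [hardInstance_update hi] at hDt hDf ht0 hf0 ⊢
  rw [hardInstance_update hi]
  simp only [if_true, Bool.false_eq_true, if_false] at hDt hDf ht0 hf0 ⊢
  have et := ofReal_mistakeMass_update M (hardInstance Db Dh Dl σ) i Dh hDt true hcm v₂
  have ef := ofReal_mistakeMass_update M (hardInstance Db Dh Dl σ) i Dl hDf false hcm v₂
  set mt := mistakeMass M (Function.update (hardInstance Db Dh Dl σ) i Dh) true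
    (criticalInterval v₁ v₂) v₂ i
  set mf := mistakeMass M (Function.update (hardInstance Db Dh Dl σ) i Dl) false
    (criticalInterval v₁ v₂) v₂ i
  set c := ENNReal.ofReal (1 / √2) with hc
  have hmeas : ∀ b : Bool, Measurable fun z : (Fin n → ℝ) × ℝ =>
      ENNReal.ofReal (mistake b (M.alloc (Function.update z.1 i z.2) i)) := fun b =>
    ((measurable_mistake b).comp ((M.measurable_alloc i).comp
      (measurable_update_uncurry i))).ennreal_ofReal
  have hsec : ∀ (b : Bool) (w : Fin n → ℝ), Measurable fun v : ℝ =>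
      ENNReal.ofReal (mistake b (M.alloc (Function.update w i v) i)) := fun b w =>
    (hmeas b).comp measurable_prodMk_left
  have key : c * Dh (criticalInterval v₁ v₂)
      * Measure.pi (hardInstance Db Dh Dl σ) (othersBelow v₂ i)
      ≤ c * ENNReal.ofReal mt + ENNReal.ofReal mf := by
    rw [et, ef, ← lintegral_const_mul' _ _ ENNReal.ofReal_ne_top, ← setLIntegral_const,
      ← lintegral_add_left ((hmeas true).lintegral_prod_right'.const_mul c)]
    refine lintegral_mono fun w => ?_
    have h1 : c * ∫⁻ v in criticalInterval v₁ v₂,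
          ENNReal.ofReal (mistake false (M.alloc (Function.update w i v) i)) ∂Dh
        ≤ ∫⁻ v in criticalInterval v₁ v₂,
          ENNReal.ofReal (mistake false (M.alloc (Function.update w i v) i)) ∂Dl := by
      rw [← smul_eq_mul, ← lintegral_smul_measure]
      exact lintegral_mono' H.smul_restrict_le le_rfl
    refine le_trans ?_ (add_le_add le_rfl h1)
    rw [← mul_add, ← lintegral_add_left (hsec true w)]
    gcongr
    calc Dh (criticalInterval v₁ v₂) = ∫⁻ _ in criticalInterval v₁ v₂, 1 ∂Dh := by simp
      _ ≤ _ := by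
        refine lintegral_mono fun v => ?_
        rw [← ENNReal.ofReal_one]
        refine le_trans (le_of_eq ?_) ENNReal.ofReal_add_le
        simp [mistake]
  have h3 := H.one_third_le_othersBelow hn σ i
  have hp : ENNReal.ofReal p ≤ Dh (criticalInterval v₁ v₂) := by
    rw [← ofReal_measureReal]
    exact ENNReal.ofReal_le_ofReal H.prob_critical.1
  have key2 : c * ENNReal.ofReal p * ENNReal.ofReal (1 / 3)
      ≤ c * ENNReal.ofReal mt + ENNReal.ofReal mf :=
    le_trans (by gcongr) key
  have hc0 : (0 : ℝ) ≤ 1 / √2 := by positivity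
  rw [hc, ← ENNReal.ofReal_mul hc0, ← ENNReal.ofReal_mul (mul_nonneg hc0 H.p_pos.le),
    ← ENNReal.ofReal_mul hc0, ← ENNReal.ofReal_add (mul_nonneg hc0 ht0) hf0,
    ENNReal.ofReal_le_ofReal_iff (by positivity)] at key2
  have hs2 : √2 ≤ 3 / 2 := by
    rw [Real.sqrt_le_left (by norm_num)]; norm_num
  have hs1 : 1 ≤ √2 := by
    rw [Real.one_le_sqrt]; norm_num
  have hc1 : 1 / √2 ≤ 1 := by
    rw [div_le_one (by positivity)]; exact hs1
  have hc2 : 2 / 3 ≤ 1 / √2 := by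
    rw [div_le_div_iff₀ (by norm_num) (by positivity)]; linarith
  have h4 := mul_le_mul_of_nonneg_right hc1 ht0
  have h5 := mul_le_mul_of_nonneg_right hc2 H.p_pos.le
  linarith [H.p_pos]

end Hard

/-! ### Averaging over the hard family -/

theorem hardInstance_mem_hardFamily {n : ℕ} (Db Dh Dl : Measure ℝ) (σ : Fin n → Bool) :
    hardInstance Db Dh Dl σ ∈ hardFamily n Db Dh Dl := by
  intro i
  unfold hardInstance
  refine ⟨fun h => by simp [h], fun h => ?_⟩
  rw [if_neg h]
  split_ifs
  · exact Or.inl rfl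
  · exact Or.inr rfl

theorem measurable_mistakeMass_output {n m : ℕ} {Ω : Type*} [MeasurableSpace Ω]
    (A : LearningAlgorithm n m Ω) (D : Fin n → Measure ℝ) [∀ i, IsProbabilityMeasure (D i)]
    (high : Bool) {U : Set ℝ} (hU : MeasurableSet U) (v₂ : ℝ) (i : Fin n) :
    Measurable fun z => mistakeMass (A.output z) D high U v₂ i := by
  have h : Measurable fun z : ((Fin m → Fin n → ℝ) × Ω) × (Fin n → ℝ) =>
      (soleContender U v₂ i).indicator
        (fun w => mistake high ((A.output z.1).alloc w i)) z.2 := by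
    have h1 : Measurable (((fun z : ((Fin m → Fin n → ℝ) × Ω) × (Fin n → ℝ) => z.2) ⁻¹'
        soleContender U v₂ i).indicator
          fun z => mistake high ((A.output z.1).alloc z.2 i)) :=
      ((measurable_mistake high).comp (A.measurable_alloc i)).indicator
        (measurable_snd (measurableSet_soleContender hU v₂ i))
    exact h1
  exact (h.stronglyMeasurable.integral_prod_right' (ν := Measure.pi D)).measurable

/-- A function on the cube whose values at neighbours in direction `i` add up to at least `c` has
average at least `c / 2`. -/
theorem sum_cube_ge {n : ℕ} (i : Fin n) (g : (Fin n → Bool) → ℝ) {c : ℝ}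
    (h : ∀ σ, c ≤ g (Function.update σ i true) + g (Function.update σ i false)) :
    Fintype.card (Fin n → Bool) * (c / 2) ≤ ∑ σ, g σ := by
  have hinv : Function.Involutive fun σ : Fin n → Bool => Function.update σ i (!σ i) := by
    intro σ
    simp
  have h1 : ∑ σ, g (Function.update σ i (!σ i)) = ∑ σ, g σ :=
    Equiv.sum_comp hinv.toPerm g
  have h2 : ∑ _σ : Fin n → Bool, c ≤ ∑ σ, (g σ + g (Function.update σ i (!σ i))) := by
    refine Finset.sum_le_sum fun σ _ => (h σ).trans (le_of_eq ?_)
    cases hσ : σ i with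
    | true =>
      have : Function.update σ i true = σ := by rw [← hσ, Function.update_eq_self]
      simp [this]
    | false =>
      have : Function.update σ i false = σ := by rw [← hσ, Function.update_eq_self]
      simp [this, add_comm]
  rw [Finset.sum_add_distrib, h1, Finset.sum_const, nsmul_eq_mul, Finset.card_univ] at h2
  linarith

theorem card_filter_val_ne_zero {n : ℕ} (hn : 2 ≤ n) :
    ((Finset.univ.filter fun i : Fin n => i.val ≠ 0).card : ℝ) = n - 1 := by
  have : (Finset.univ.filter fun i : Fin n => i.val ≠ 0)
      = Finset.univ.erase (⟨0, by omega⟩ : Fin n) := by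
    ext j; simp [Fin.ext_iff]
  rw [this, Finset.card_erase_of_mem (Finset.mem_univ _), Finset.card_univ, Fintype.card_fin,
    Nat.cast_sub (by omega)]
  simp

section Hard

variable {n : ℕ} {Db Dh Dl : Measure ℝ} {v₀ : ℝ} {v₁ : EReal} {v₂ p Δ : ℝ}
  {m : ℕ} {Ω : Type*} [MeasurableSpace Ω]

/-- The samples for which the output of `A` makes many mistakes about bidder `i` on the
instance `σ`. -/
def badEvent (A : LearningAlgorithm n m Ω) (Db Dh Dl : Measure ℝ) (v₁ : EReal) (v₂ p : ℝ)
    (i : Fin n) (σ : Fin n → Bool) : Set ((Fin m → Fin n → ℝ) × Ω) :=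
  {z | p / 10 ≤ mistakeMass (A.output z) (hardInstance Db Dh Dl σ) (σ i)
    (criticalInterval v₁ v₂) v₂ i}

theorem HardConditions.measurableSet_badEvent (H : HardConditions n Db Dh Dl v₀ v₁ v₂ p Δ)
    (A : LearningAlgorithm n m Ω) (i : Fin n) (σ : Fin n → Bool) :
    MeasurableSet (badEvent A Db Dh Dl v₁ v₂ p i σ) := by
  have := fun i => (H.isValueDistribution σ i).prob
  exact measurableSet_le measurable_const
    (measurable_mistakeMass_output A _ _ (measurableSet_criticalInterval v₁ v₂) v₂ i)

theorem HardConditions.isProbabilityMeasure_sampleLaw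
    (H : HardConditions n Db Dh Dl v₀ v₁ v₂ p Δ) (m : ℕ) (P : Measure Ω) [IsProbabilityMeasure P]
    (σ : Fin n → Bool) : IsProbabilityMeasure (sampleLaw m (hardInstance Db Dh Dl σ) P) := by
  have := fun i => (H.isValueDistribution σ i).prob
  unfold sampleLaw
  infer_instance

/-- Few samples do not distinguish two instances that differ in one bidder, so the algorithm is
often wrong about her on one of them. -/
theorem HardConditions.badEvent_add_ge (H : HardConditions n Db Dh Dl v₀ v₁ v₂ p Δ) (hn : 2 ≤ n)
    (A : LearningAlgorithm n m Ω) (P : Measure Ω) [IsProbabilityMeasure P]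
    (hkl : m * InformationTheory.klDiv Dl Dh ≤ ENNReal.ofReal (1 / 16)) {i : Fin n}
    (hi : i.val ≠ 0) (σ : Fin n → Bool) :
    1 / 2 ≤ (sampleLaw m (hardInstance Db Dh Dl (Function.update σ i true)) P).real
        (badEvent A Db Dh Dl v₁ v₂ p i (Function.update σ i true))
      + (sampleLaw m (hardInstance Db Dh Dl (Function.update σ i false)) P).real
        (badEvent A Db Dh Dl v₁ v₂ p i (Function.update σ i false)) := by
  have hprob := fun i => (H.isValueDistribution σ i).prob
  have := H.dist_high.prob
  have := H.dist_low.prob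
  have := H.isProbabilityMeasure_sampleLaw m P (Function.update σ i true)
  have := H.isProbabilityMeasure_sampleLaw m P (Function.update σ i false)
  have hmt := H.measurableSet_badEvent A i (Function.update σ i true)
  have hcover : (badEvent A Db Dh Dl v₁ v₂ p i (Function.update σ i true))ᶜ
      ⊆ badEvent A Db Dh Dl v₁ v₂ p i (Function.update σ i false) := by
    intro z hz
    have h := H.mistakeMass_add_ge hn σ hi (A.output z)
    simp only [badEvent, mem_compl_iff, mem_ofPred_eq, Function.update_self, not_le] at hz ⊢
    linarith
  have hdiv := klDiv_sampleLaw_update_le m P (hardInstance Db Dh Dl σ) i Dl Dh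
  have e1 := hardInstance_update (Db := Db) (Dh := Dh) (Dl := Dl) (σ := σ) hi true
  have e2 := hardInstance_update (Db := Db) (Dh := Dh) (Dl := Dl) (σ := σ) hi false
  simp only [if_true, Bool.false_eq_true, if_false] at e1 e2
  rw [← e1, ← e2] at hdiv
  have h1 := measureReal_le_add_half_of_klDiv_le _ _ (hdiv.trans hkl) hmt
  have h2 := measureReal_mono (μ := sampleLaw m
    (hardInstance Db Dh Dl (Function.update σ i false)) P) hcover
  rw [probReal_compl_eq_one_sub hmt] at h2
  linarith

/-- On an instance that it learns, the algorithm is rarely wrong about an average bidder. -/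
theorem HardConditions.sum_badEvent_le (H : HardConditions n Db Dh Dl v₀ v₁ v₂ p Δ) (hn : 2 ≤ n)
    (A : LearningAlgorithm n m Ω) (P : Measure Ω) [IsProbabilityMeasure P] (σ : Fin n → Bool)
    (hlearn : LearnsUpTo A P (hardInstance Db Dh Dl σ) (1 / 2000 * (n * p * Δ))) :
    ∑ i ∈ Finset.univ.filter (fun i : Fin n => i.val ≠ 0),
        (sampleLaw m (hardInstance Db Dh Dl σ) P).real (badEvent A Db Dh Dl v₁ v₂ p i σ)
      ≤ (n - 1) * 0.02 := by
  classical
  have hprob := fun i => (H.isValueDistribution σ i).prob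
  have := H.isProbabilityMeasure_sampleLaw m P σ
  set I := Finset.univ.filter (fun i : Fin n => i.val ≠ 0) with hI
  set μ := sampleLaw m (hardInstance Db Dh Dl σ) P with hμ
  have hcard : (I.card : ℝ) = n - 1 :=
    card_filter_val_ne_zero hn
  set X : (Fin m → Fin n → ℝ) × Ω → ℝ := fun z => ∑ i ∈ I, mistakeMass (A.output z)
    (hardInstance Db Dh Dl σ) (σ i) (criticalInterval v₁ v₂) v₂ i with hX
  have hXm : Measurable X := Finset.measurable_fun_sum _ fun i _ =>
    measurable_mistakeMass_output A _ _ (measurableSet_criticalInterval v₁ v₂) v₂ i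
  set G := {z | X z ≤ 1 / 2000 * (n * p)} with hG
  have hGm : MeasurableSet G := measurableSet_le hXm measurable_const
  have hGp : 0.99 ≤ μ.real G := by
    refine hlearn.trans (measureReal_mono fun z hz => ?_)
    have h := H.regret_le hn σ hz.1 hz.2
    have h2 : Δ * X z ≤ Δ * (1 / 2000 * (n * p)) := h.trans (le_of_eq (by ring))
    exact le_of_mul_le_mul_left h2 H.Δ_pos
  have hGc : μ.real Gᶜ ≤ 0.01 := by
    rw [probReal_compl_eq_one_sub hGm]
    norm_num at hGp ⊢
    linarith
  have hn1 : (1 : ℝ) ≤ n - 1 := by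
    have : (2 : ℝ) ≤ n := by exact_mod_cast hn
    linarith
  have hpt : ∀ z, ∑ i ∈ I, (badEvent A Db Dh Dl v₁ v₂ p i σ).indicator (fun _ => (1 : ℝ)) z
      ≤ (n - 1) * 0.01 + Gᶜ.indicator (fun _ => (n : ℝ) - 1) z := by
    intro z
    by_cases hz : z ∈ G
    · rw [indicator_of_notMem (by simpa using hz), add_zero]
      have h1 : (p / 10) * ∑ i ∈ I, (badEvent A Db Dh Dl v₁ v₂ p i σ).indicator
          (fun _ => (1 : ℝ)) z ≤ X z := by
        rw [Finset.mul_sum]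
        refine Finset.sum_le_sum fun i _ => ?_
        by_cases hb : z ∈ badEvent A Db Dh Dl v₁ v₂ p i σ
        · rw [indicator_of_mem hb, mul_one]; exact hb
        · rw [indicator_of_notMem hb, mul_zero]
          refine integral_nonneg_of_ae ?_
          filter_upwards [ae_pi_nonneg _ (H.isValueDistribution σ)] with w hw
          refine indicator_apply_nonneg fun _ => ?_
          exact (mistake_mem_unit (σ i) ((A.output z).alloc_nonneg w hw i)
            ((A.output z).alloc_le_one hw i)).1
      have h2 : X z ≤ 1 / 2000 * (n * p) := hz
      have h3 : (p / 10) * ∑ i ∈ I, (badEvent A Db Dh Dl v₁ v₂ p i σ).indicator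
          (fun _ => (1 : ℝ)) z ≤ (p / 10) * ((n - 1) * 0.01) := by
        refine (h1.trans h2).trans ?_
        -- at most `n / 200` bidders have a mistake mass of `p / 10`, and `n ≤ 2 (n - 1)`
        nlinarith [mul_nonneg H.p_pos.le (sub_nonneg.mpr hn1)]
      exact le_of_mul_le_mul_left h3 (by linarith [H.p_pos])
    · rw [indicator_of_mem (by simpa using hz), ← hcard]
      have : ∑ i ∈ I, (badEvent A Db Dh Dl v₁ v₂ p i σ).indicator (fun _ => (1 : ℝ)) z
          ≤ ∑ _i ∈ I, (1 : ℝ) := by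
        refine Finset.sum_le_sum fun i _ => ?_
        by_cases hb : z ∈ badEvent A Db Dh Dl v₁ v₂ p i σ
        · rw [indicator_of_mem hb]
        · rw [indicator_of_notMem hb]; exact zero_le_one
      simp only [Finset.sum_const, nsmul_eq_mul, mul_one] at this
      have hI0 : (0 : ℝ) ≤ I.card := Nat.cast_nonneg _
      linarith
  have hbm := fun i => H.measurableSet_badEvent A i σ
  have hint : ∀ i ∈ I, Integrable ((badEvent A Db Dh Dl v₁ v₂ p i σ).indicator
      fun _ => (1 : ℝ)) μ := fun i _ => (integrable_const _).indicator (hbm i)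
  have hI2 : Integrable (fun z => ((n : ℝ) - 1) * 0.01 + Gᶜ.indicator (fun _ => (n : ℝ) - 1) z) μ :=
    (integrable_const _).add ((integrable_const _).indicator hGm.compl)
  have hmain := integral_mono (integrable_finsetSum I hint) hI2 hpt
  rw [integral_finsetSum I hint, integral_add (integrable_const _)
    ((integrable_const _).indicator hGm.compl), integral_indicator hGm.compl] at hmain
  have hterm : ∀ i, ∫ z, (badEvent A Db Dh Dl v₁ v₂ p i σ).indicator (fun _ => (1 : ℝ)) z ∂μ
      = μ.real (badEvent A Db Dh Dl v₁ v₂ p i σ) := fun i => by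
    rw [integral_indicator (hbm i)]; simp
  simp only [hterm, integral_const, probReal_univ, smul_eq_mul, one_mul,
    measureReal_restrict_apply_univ] at hmain
  have := mul_le_mul_of_nonneg_right hGc (show (0 : ℝ) ≤ n - 1 by linarith)
  norm_num at this hmain ⊢
  linarith

end Hard

end

theorem mainTheorem3 :
    ∃ c₁ c₂ : ℝ, 0 < c₁ ∧ 0 < c₂ ∧
      ∀ (n : ℕ) (Db Dh Dl : MeasureTheory.Measure ℝ) (v₀ : ℝ) (v₁ : EReal) (v₂ p Δ : ℝ),
        2 ≤ n → HardConditions n Db Dh Dl v₀ v₁ v₂ p Δ →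
        ∀ (m : ℕ) (Ω : Type*) [MeasurableSpace Ω] (P : MeasureTheory.Measure Ω)
          [MeasureTheory.IsProbabilityMeasure P] (A : LearningAlgorithm n m Ω),
          (∀ D ∈ hardFamily n Db Dh Dl, LearnsUpTo A P D (c₁ * (n * p * Δ))) →
          ENNReal.ofReal c₂ * (sklDiv Dh Dl)⁻¹ ≤ (m : ENNReal) := by
  -- `1 / 16` is the divergence below which events differ in probability by at most `1 / 2`
  refine ⟨1 / 2000, 1 / 16, by norm_num, by norm_num, ?_⟩
  intro n Db Dh Dl v₀ v₁ v₂ p Δ hn H m Ω _ P _ A hA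
  by_contra hcon
  have hlt := (not_le.mp hcon).le
  rw [← div_eq_mul_inv, ENNReal.le_div_iff_mul_le (Or.inr (by simp))
    (Or.inr ENNReal.ofReal_ne_top)] at hlt
  have hkl : m * InformationTheory.klDiv Dl Dh ≤ ENNReal.ofReal (1 / 16) := by
    refine le_trans ?_ hlt
    gcongr
    exact le_add_self
  set I := Finset.univ.filter (fun i : Fin n => i.val ≠ 0) with hI
  set N : ℝ := ((Fintype.card (Fin n → Bool) : ℕ) : ℝ) with hN
  have hNpos : 0 < N := by
    rw [hN]; exact_mod_cast Fintype.card_pos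
  -- over all instances and bidders, the failure probabilities average to at most `0.02` because
  -- the algorithm learns, but to at least `1 / 4` because neighbours are indistinguishable
  have hup : ∑ σ : Fin n → Bool, ∑ i ∈ I, (sampleLaw m (hardInstance Db Dh Dl σ) P).real
      (badEvent A Db Dh Dl v₁ v₂ p i σ) ≤ N * ((n - 1) * 0.02) := by
    have := Finset.sum_le_card_nsmul Finset.univ _ _ fun (σ : Fin n → Bool) _ =>
      H.sum_badEvent_le hn A P σ (hA _ (hardInstance_mem_hardFamily Db Dh Dl σ))
    rwa [nsmul_eq_mul, Finset.card_univ] at this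
  have hlo : ∑ i ∈ I, ∑ σ : Fin n → Bool, (sampleLaw m (hardInstance Db Dh Dl σ) P).real
      (badEvent A Db Dh Dl v₁ v₂ p i σ) ≥ I.card * (N * ((1 / 2) / 2)) := by
    have := Finset.card_nsmul_le_sum I _ _ fun i hi => sum_cube_ge i
      (fun σ => (sampleLaw m (hardInstance Db Dh Dl σ) P).real
        (badEvent A Db Dh Dl v₁ v₂ p i σ))
      (fun σ => H.badEvent_add_ge hn A P hkl (Finset.mem_filter.mp hi).2 σ)
    rwa [nsmul_eq_mul] at this
  have hcard : (I.card : ℝ) = n - 1 :=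
    card_filter_val_ne_zero hn
  rw [Finset.sum_comm, hcard] at hlo
  have hn1 : (1 : ℝ) ≤ n - 1 := by
    have : (2 : ℝ) ≤ n := by exact_mod_cast hn
    linarith
  have hpos : 0 < N * ((n : ℝ) - 1) := mul_pos hNpos (by linarith)
  norm_num at hup hlo
  linarith
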